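/- Theorem. Let $\mathbb D=\{z\in\mathbb C:|z|<1\}$, $\mathbb D(0,R)=\{z\in\mathbb C:|z|<R\}$, and let $D\subset\mathbb C$ be a domain (a nonempty connected open set). Write $\mathcal O(\mathbb D,D)$ for the set of holomorphic maps $\mathbb D\to D$. For $z,w\in\mathbb D$ let $$\omega(z,w)=\tanh^{-1}\left|\frac{z-w}{1-\bar w z}\right|$$ be the Poincaré distance. The Kobayashi pseudodistance $d_D(p,q)$ of $p,q\in D$ is the infimum of the sums $\sum_{i=1}^k\omega(a_i,b_i)$ over all $k\ge 1$, all points $p=p_0,\dots,p_k=q$ of $D$, all $a_i,b_i\in\mathbb D$ and all $f_i\in\mathcal O(\mathbb D,D)$ with $f_i(a_i)=p_{i-1}$ and $f_i(b_i)=p_i$ for $i=1,\dots,k$. The following statements are equivalent. 1. The complement $\mathbb C\setminus D$ contains at least two points. 2. $D$ is Kobayashi hyperbolic: $d_D$ is a genuine distance on $D$. 3. $D$ is complete Kobayashi hyperbolic: $d_D$ is a genuine distance on $D$ and the metric space $(D,d_D)$ is complete. 4. $D$ has the Landau property: for each $a\in D$ there is $R(a)>0$ such that for every holomorphic $f:\mathbb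 D(0,R(a))\to\mathbb C$ with $f(0)=a$ and $|f'(0)|=1$, the image $f(\mathbb D(0,R(a)))$ is not contained in $D$. 5. $D$ has the Schottky property: for all $a\in D$, $R>0$ and $0<r<1$ there is a constant $M>0$ (depending on $a$, $R$, $r$) such that every $f\in\mathcal O(\mathbb D,D)$ with $d_D(a,f(0))<R$ satisfies $|f(z)|\le M$ for all $|z|\le r$. 6. $D$ has the Picard property ($D$ is Brody hyperbolic): every holomorphic map $f:\mathbb C\to D$ is constant. 7. $D$ has the Montel property: the family $\mathcal O(\mathbb D,D)$ is normal, i.e. every sequence $(f_n)$ in it either has a subsequence converging uniformly on compact subsets of $\mathbb D$ to a holomorphic map $\mathbb D\to D$, or diverges compactly: for all compact $K\subset\mathbb D$ and $L\subset D$ there is $N$ such that $f_n(K)\cap L=\emptyset$ for all $n>N$. -/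

import Mathlib

open Set Metric Filter Topology
open scoped ENNReal ComplexConjugate

/-- `holMaps U D` is `O(U, D)`, the family of holomorphic maps from the open set `U ⊆ ℂ` into
`D ⊆ ℂ`. Maps are represented by functions `ℂ → ℂ`; only their values on `U` matter. -/
def holMaps (U D : Set ℂ) : Set (ℂ → ℂ) :=
  {f | DifferentiableOn ℂ f U ∧ MapsTo f U D}

/-- The Poincaré distance
`ω(z, w) = (1/2) log ((1 + t) / (1 - t))`, `t = |(z - w) / (1 - conj w * z)|`, on the unit disk. -/
noncomputable def poincareDist (z w : ℂ) : ℝ :=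
  1 / 2 * Real.log ((1 + ‖(z - w) / (1 - conj w * z)‖) / (1 - ‖(z - w) / (1 - conj w * z)‖))

/-- A chain of holomorphic disks in `D` from `p` to `q`. It consists of points
`p = pt 0, …, pt k = q` with `k ≥ 1`, and, for `i < k`, a holomorphic map `f i : 𝔻 → D` and points
`a i, b i ∈ 𝔻` with `f i (a i) = pt i` and `f i (b i) = pt (i + 1)`.
(The values of `pt`, `a`, `b`, `f` at larger indices play no role.) -/
structure DiskChain (D : Set ℂ) (p q : ℂ) where
  k : ℕ
  pt : ℕ → ℂ
  a : ℕ → ℂ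
  b : ℕ → ℂ
  f : ℕ → ℂ → ℂ
  one_le : 1 ≤ k
  pt_zero : pt 0 = p
  pt_last : pt k = q
  a_mem : ∀ i < k, a i ∈ ball (0 : ℂ) 1
  b_mem : ∀ i < k, b i ∈ ball (0 : ℂ) 1
  f_mem : ∀ i < k, f i ∈ holMaps (ball 0 1) D
  f_a : ∀ i < k, f i (a i) = pt i
  f_b : ∀ i < k, f i (b i) = pt (i + 1)

/-- The length `∑ ω(a i, b i)` of a chain of holomorphic disks. -/
noncomputable def DiskChain.length {D : Set ℂ} {p q : ℂ} (c : DiskChain D p q) : ℝ≥0∞ :=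
  ∑ i ∈ Finset.range c.k, ENNReal.ofReal (poincareDist (c.a i) (c.b i))

/-- The Kobayashi pseudodistance `d_D(p, q)` of `p, q ∈ D`: the infimum of the lengths of all
chains of holomorphic disks in `D` from `p` to `q` (`⊤` if there is no chain). -/
noncomputable def kobayashiDist (D : Set ℂ) (p q : ℂ) : ℝ≥0∞ :=
  ⨅ c : DiskChain D p q, c.length

theorem poincareDist_comm (z w : ℂ) : poincareDist z w = poincareDist w z := by
  have h : ‖(z - w) / (1 - conj w * z)‖ = ‖(w - z) / (1 - conj z * w)‖ := by
    rw [norm_div, norm_div, norm_sub_rev z w]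
    congr 1
    rw [← Complex.norm_conj (1 - conj w * z)]
    congr 1
    simp [mul_comm]
  unfold poincareDist
  rw [h]

theorem kobayashiDist_self {D : Set ℂ} {p : ℂ} (hp : p ∈ D) : kobayashiDist D p p = 0 := by
  let c : DiskChain D p p :=
    { k := 1, pt := fun _ => p, a := fun _ => 0, b := fun _ => 0, f := fun _ _ => p
      one_le := le_rfl, pt_zero := rfl, pt_last := rfl
      a_mem := by simp, b_mem := by simp
      f_mem := fun _ _ => ⟨differentiableOn_const p, fun _ _ => hp⟩
      f_a := fun _ _ => rfl, f_b := fun _ _ => rfl }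
  have h : kobayashiDist D p p ≤ c.length := iInf_le _ c
  have h0 : c.length = 0 := by simp [DiskChain.length, c, poincareDist]
  exact le_antisymm (h.trans h0.le) bot_le

theorem kobayashiDist_le_swap (D : Set ℂ) (p q : ℂ) :
    kobayashiDist D q p ≤ kobayashiDist D p q := by
  refine le_iInf fun c => ?_
  let c' : DiskChain D q p :=
    { k := c.k, pt := fun i => c.pt (c.k - i), a := fun i => c.b (c.k - 1 - i)
      b := fun i => c.a (c.k - 1 - i), f := fun i => c.f (c.k - 1 - i)
      one_le := c.one_le, pt_zero := by simpa using c.pt_last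
      pt_last := by simpa using c.pt_zero
      a_mem := fun i hi => c.b_mem _ (by omega)
      b_mem := fun i hi => c.a_mem _ (by omega)
      f_mem := fun i hi => c.f_mem _ (by omega)
      f_a := fun i hi => by
        rw [c.f_b _ (by omega)]
        congr 1
        omega
      f_b := fun i hi => by
        rw [c.f_a _ (by omega)]
        congr 1
        omega }
  refine (iInf_le _ c').trans (le_of_eq ?_)
  have h := Finset.sum_range_reflect
    (fun i => ENNReal.ofReal (poincareDist (c.a i) (c.b i))) c.k
  rw [DiskChain.length, DiskChain.length, ← h]
  exact Finset.sum_congr rfl fun i _ => by rw [poincareDist_comm]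

theorem kobayashiDist_comm (D : Set ℂ) (p q : ℂ) : kobayashiDist D p q = kobayashiDist D q p :=
  le_antisymm (kobayashiDist_le_swap D q p) (kobayashiDist_le_swap D p q)

theorem kobayashiDist_triangle (D : Set ℂ) (p q r : ℂ) :
    kobayashiDist D p r ≤ kobayashiDist D p q + kobayashiDist D q r := by
  refine ENNReal.le_iInf_add_iInf fun c d => ?_
  let e : DiskChain D p r :=
    { k := c.k + d.k
      pt := fun i => if i < c.k then c.pt i else d.pt (i - c.k)
      a := fun i => if i < c.k then c.a i else d.a (i - c.k)
      b := fun i => if i < c.k then c.b i else d.b (i - c.k)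
      f := fun i => if i < c.k then c.f i else d.f (i - c.k)
      one_le := by have := c.one_le; omega
      pt_zero := by
        have := c.one_le
        rw [if_pos (by omega)]
        exact c.pt_zero
      pt_last := by simpa using d.pt_last
      a_mem := fun i hi => by
        split_ifs with h
        exacts [c.a_mem _ h, d.a_mem _ (by omega)]
      b_mem := fun i hi => by
        split_ifs with h
        exacts [c.b_mem _ h, d.b_mem _ (by omega)]
      f_mem := fun i hi => by
        split_ifs with h
        exacts [c.f_mem _ h, d.f_mem _ (by omega)]
      f_a := fun i hi => by
        split_ifs with h
        exacts [c.f_a _ h, d.f_a _ (by omega)]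
      f_b := fun i hi => by
        by_cases h : i < c.k
        · rw [if_pos h, if_pos h, c.f_b _ h]
          by_cases h' : i + 1 < c.k
          · rw [if_pos h']
          · rw [if_neg h', show i + 1 = c.k by omega, c.pt_last, Nat.sub_self, d.pt_zero]
        · rw [if_neg h, if_neg h, if_neg (by omega), d.f_b _ (by omega)]
          congr 1
          omega }
  refine (iInf_le _ e).trans (le_of_eq ?_)
  rw [DiskChain.length, DiskChain.length, DiskChain.length, Finset.sum_range_add]
  refine congrArg₂ (· + ·) (Finset.sum_congr rfl fun i hi => ?_)
    (Finset.sum_congr rfl fun i _ => ?_)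
  · have hi' := Finset.mem_range.mp hi
    simp [e, hi']
  · simp [e]

/-- `D` with its Kobayashi pseudodistance. -/
noncomputable abbrev kobayashiSpace (D : Set ℂ) : PseudoEMetricSpace D where
  edist p q := kobayashiDist D p q
  edist_self p := kobayashiDist_self p.2
  edist_comm p q := kobayashiDist_comm D p q
  edist_triangle p q r := kobayashiDist_triangle D p q r

/-- `D` is Kobayashi hyperbolic: the Kobayashi pseudodistance is a genuine distance on `D`, that is,
it is finite and separates points (symmetry and the triangle inequality always hold). -/
def IsKobayashiHyperbolic (D : Set ℂ) : Prop :=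
  ∀ p ∈ D, ∀ q ∈ D, kobayashiDist D p q ≠ ⊤ ∧ (kobayashiDist D p q = 0 → p = q)

/-- `D` is complete Kobayashi hyperbolic: the Kobayashi pseudodistance is a genuine distance on `D`
and the resulting metric space is complete. -/
def IsCompleteKobayashiHyperbolic (D : Set ℂ) : Prop :=
  IsKobayashiHyperbolic D ∧ @CompleteSpace D (kobayashiSpace D).toUniformSpace

/-- The Landau property. -/
def LandauProperty (D : Set ℂ) : Prop :=
  ∀ a ∈ D, ∃ R : ℝ, 0 < R ∧ ∀ f : ℂ → ℂ, DifferentiableOn ℂ f (ball 0 R) →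
    f 0 = a → ‖deriv f 0‖ = 1 → ¬ f '' ball 0 R ⊆ D

/-- The Schottky property: for all `a ∈ D`, `R > 0` and `0 < r < 1`, the holomorphic maps
`f : 𝔻 → D` with `d_D(a, f 0) < R` are uniformly bounded on `|z| ≤ r`. -/
def SchottkyProperty (D : Set ℂ) : Prop :=
  ∀ a ∈ D, ∀ R : ℝ, 0 < R → ∀ r : ℝ, 0 < r → r < 1 → ∃ M : ℝ, 0 < M ∧
    ∀ f ∈ holMaps (ball 0 1) D, kobayashiDist D a (f 0) < ENNReal.ofReal R →
      ∀ z : ℂ, ‖z‖ ≤ r → ‖f z‖ ≤ M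

/-- The Picard property (Brody hyperbolicity): every holomorphic map `ℂ → D` is constant. -/
def PicardProperty (D : Set ℂ) : Prop :=
  ∀ f ∈ holMaps univ D, ∃ c : ℂ, ∀ z : ℂ, f z = c

/-- The sequence `F` of maps on `U` converges to `g` uniformly on the compact subsets of `U`
(that is, in the compact-open topology). -/
def ConvergesOnCompacts (U : Set ℂ) (F : ℕ → ℂ → ℂ) (g : ℂ → ℂ) : Prop :=
  ∀ K ⊆ U, IsCompact K → TendstoUniformlyOn F g atTop K

/-- The sequence `F` of maps `U → D` diverges compactly. -/
def DivergesCompactly (U D : Set ℂ) (F : ℕ → ℂ → ℂ) : Prop :=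
  ∀ K ⊆ U, IsCompact K → ∀ L ⊆ D, IsCompact L → ∃ N : ℕ, ∀ n > N, F n '' K ∩ L = ∅

/-- The family `𝓕 ⊆ O(U, D)` is normal: every sequence in `𝓕` either has a subsequence that
converges in the compact-open topology to a holomorphic map `U → D`, or diverges compactly. -/
def IsNormalFamily (U D : Set ℂ) (𝓕 : Set (ℂ → ℂ)) : Prop :=
  ∀ F : ℕ → ℂ → ℂ, (∀ n, F n ∈ 𝓕) →
    (∃ φ : ℕ → ℕ, StrictMono φ ∧
      ∃ g ∈ holMaps U D, ConvergesOnCompacts U (fun n => F (φ n)) g) ∨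
    DivergesCompactly U D F

/-- The Montel property: `O(𝔻, D)` is a normal family. -/
def MontelProperty (D : Set ℂ) : Prop :=
  IsNormalFamily (ball 0 1) D (holMaps (ball 0 1) D)

/-! The core is a quantitative Landau theorem, `norm_deriv_zero_le_landauBound`: a holomorphic map f
from the unit disk to ℂ ∖ {0, 1} satisfies |f'(0)| ≤ C (1 + |f(0)|) log (4 + |f(0)|²). On the disk
one can write 2f - 1 = cos πH with H omitting the integers, then H = cos πG, where G omits a set
that meets every disk of radius 2. Bloch's theorem bounds G'(0), and the chain rule gives the
estimate.

Integrated along disks and chains, this makes functions of small gradient Lipschitz for the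
Kobayashi pseudodistance. Two of them suffice. Since ∫ dr / (r log r) diverges, `logLog` is
Lipschitz and yet tends to infinity, so Kobayashi balls are bounded: this gives Schottky's bounds
and keeps Cauchy sequences from escaping to infinity. The function `sep p` vanishes only at p, so
the pseudodistance separates points and controls the Euclidean one on bounded sets. If D omits two
points, an affine map carries it into ℂ ∖ {0, 1}; a Möbius map with its pole at an omitted point
keeps Cauchy sequences from converging to that point. The same bounds, with Arzelà–Ascoli and
Hurwitz, give Montel's property. Landau's property implies Picard's by rescaling.

Conversely, if D misses at most one point w, the maps w + exp (n z) refute hyperbolicity and the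
Schottky, Picard and Montel properties. -/

/-! ### Bloch's theorem -/

/-- If `|f'| ≤ 2 |f'(a)|` on the disk of radius `t` about `a`, then the image of that disk contains
a disk of radius `|f'(a)| t / 24`. -/
theorem ball_subset_image_of_norm_deriv_le {f : ℂ → ℂ} {a : ℂ} {t : ℝ} (ht : 0 < t)
    (hf : DifferentiableOn ℂ f (ball a t)) (h0 : deriv f a ≠ 0)
    (hb : ∀ z ∈ ball a t, ‖deriv f z‖ ≤ 2 * ‖deriv f a‖) :
    ball (f a) (‖deriv f a‖ * t / 12 / 2) ⊆ f '' ball a t := by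
  set c := ‖deriv f a‖ with hc
  have hc0 : 0 < c := norm_pos_iff.mpr h0
  have hsub : closedBall a (t / 6) ⊆ ball a t := closedBall_subset_ball (by linarith)
  have hfa : ∀ z ∈ ball a t, DifferentiableAt ℂ f z := fun z hz =>
    hf.differentiableAt (isOpen_ball.mem_nhds hz)
  have hd : DifferentiableOn ℂ (deriv f) (ball a t) := hf.deriv isOpen_ball
  have hmaps : MapsTo (deriv f) (ball a t) (closedBall (deriv f a) (3 * c)) := by
    intro z hz
    rw [mem_closedBall, dist_eq_norm]
    calc ‖deriv f z - deriv f a‖ ≤ ‖deriv f z‖ + ‖deriv f a‖ := norm_sub_le _ _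
      _ ≤ 3 * c := by linarith [hb z hz]
  -- Schwarz lemma for f'. The radius `t / 6` makes the deviation at most half of |f'(a)|, so the
  -- linear part of f dominates on the small circle.
  have hder : ∀ z ∈ closedBall a (t / 6), ‖deriv f z - deriv f a‖ ≤ c / 2 := by
    intro z hz
    have h := Complex.dist_le_div_mul_dist_of_mapsTo_ball hd hmaps (hsub hz)
    rw [dist_eq_norm] at h
    refine h.trans ?_
    calc 3 * c / t * dist z a ≤ 3 * c / t * (t / 6) := by
          gcongr
          exact hz
      _ = c / 2 := by field_simp; norm_num
  have hlin : ∀ z ∈ closedBall a (t / 6), ‖f z - f a - deriv f a * (z - a)‖ ≤ c / 2 * ‖z - a‖ := by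
    intro z hz
    have hd1 : ∀ x ∈ closedBall a (t / 6),
        HasDerivWithinAt (fun z => f z - deriv f a * z) (deriv f x - deriv f a)
          (closedBall a (t / 6)) x := by
      intro x hx
      have h1 := (hfa x (hsub hx)).hasDerivAt.fun_sub ((hasDerivAt_id x).const_mul (deriv f a))
      rw [mul_one] at h1
      exact h1.hasDerivWithinAt
    have h := (convex_closedBall a (t / 6)).norm_image_sub_le_of_norm_hasDerivWithin_le hd1 hder
      (mem_closedBall_self (by positivity)) hz
    have h2 : f z - f a - deriv f a * (z - a) = f z - deriv f a * z - (f a - deriv f a * a) := by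
      ring
    rwa [h2]
  have hsph : ∀ z ∈ sphere a (t / 6), c * t / 12 ≤ ‖f z - f a‖ := by
    intro z hz
    have h1 := hlin z (sphere_subset_closedBall hz)
    have h2 : ‖z - a‖ = t / 6 := by rw [← dist_eq_norm]; exact hz
    have h3 : ‖deriv f a * (z - a)‖ = c * (t / 6) := by rw [norm_mul, h2]
    have h4 := norm_sub_norm_le (deriv f a * (z - a)) (f z - f a)
    rw [norm_sub_rev (deriv f a * (z - a))] at h4
    rw [h2] at h1
    linarith
  refine (DiffContOnCl.ball_subset_image_closedBall (r := t / 6) ?_ (by positivity) hsph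
    ?_).trans (image_mono hsub)
  · exact (hf.mono hsub).diffContOnCl_ball subset_rfl
  · have h := (hfa a (mem_ball_self ht)).hasDerivAt.eventually_ne (c := f a) h0
    exact h.frequently.filter_mono nhdsWithin_le_nhds

/-- Bloch's theorem, with a rough constant. -/
theorem exists_ball_subset_image {f : ℂ → ℂ} (hf : DifferentiableOn ℂ f (ball 0 1))
    (h0 : deriv f 0 ≠ 0) : ∃ w, ball w (‖deriv f 0‖ / 96) ⊆ f '' ball 0 1 := by
  have hsub : closedBall (0 : ℂ) (1 / 2) ⊆ ball 0 1 := closedBall_subset_ball (by norm_num)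
  have hcont : ContinuousOn (fun z => ‖deriv f z‖ * (1 / 2 - ‖z‖)) (closedBall (0 : ℂ) (1 / 2)) :=
    ((hf.deriv isOpen_ball).continuousOn.mono hsub).norm.mul (by fun_prop)
  -- At a maximum of |f'(z)| (1/2 - |z|), |f'| at most doubles within half the distance from `a` to
  -- the circle |z| = 1/2. The smaller closed disk gives compactness.
  obtain ⟨a, ha, hmax⟩ := (isCompact_closedBall (0 : ℂ) (1 / 2)).exists_isMaxOn
    ⟨0, mem_closedBall_self (by norm_num)⟩ hcont
  have h1 : ‖deriv f 0‖ * (1 / 2) ≤ ‖deriv f a‖ * (1 / 2 - ‖a‖) := by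
    simpa using hmax (mem_closedBall_self (by norm_num) : (0 : ℂ) ∈ closedBall (0 : ℂ) (1 / 2))
  have h0' : 0 < ‖deriv f 0‖ := norm_pos_iff.mpr h0
  have ha' : ‖a‖ ≤ 1 / 2 := by simpa using ha
  have hpos : 0 < ‖deriv f a‖ * (1 / 2 - ‖a‖) := by linarith
  have hda : 0 < ‖deriv f a‖ := by
    rcases (norm_nonneg (deriv f a)).eq_or_lt with h | h
    · rw [← h] at hpos; simp at hpos
    · exact h
  have ht : 0 < 1 / 2 - ‖a‖ := (pos_iff_pos_of_mul_pos hpos).mp hda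
  set t := (1 / 2 - ‖a‖) / 2 with htdef
  have ht0 : 0 < t := by positivity
  have ht2 : 1 / 2 - ‖a‖ = 2 * t := by rw [htdef]; ring
  rw [ht2] at h1
  have hball : ball a t ⊆ closedBall (0 : ℂ) (1 / 2) := by
    intro z hz
    rw [mem_ball, dist_eq_norm] at hz
    rw [mem_closedBall, dist_zero_right]
    have := norm_le_norm_add_norm_sub a z
    rw [norm_sub_rev] at this
    linarith
  have hb : ∀ z ∈ ball a t, ‖deriv f z‖ ≤ 2 * ‖deriv f a‖ := by
    intro z hz
    have h2 : ‖deriv f z‖ * (1 / 2 - ‖z‖) ≤ ‖deriv f a‖ * (1 / 2 - ‖a‖) := hmax (hball hz)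
    rw [ht2] at h2
    rw [mem_ball, dist_eq_norm] at hz
    have h3 := norm_le_norm_add_norm_sub a z
    rw [norm_sub_rev] at h3
    have h4 : ‖deriv f z‖ * t ≤ ‖deriv f z‖ * (1 / 2 - ‖z‖) := by gcongr; linarith
    have h5 : ‖deriv f z‖ * t ≤ 2 * ‖deriv f a‖ * t := by linarith
    exact le_of_mul_le_mul_right h5 ht0
  refine ⟨f a, (ball_subset_ball ?_).trans ((ball_subset_image_of_norm_deriv_le ht0
    (hf.mono (hball.trans hsub)) (norm_pos_iff.mp hda) hb).trans
    (image_mono (hball.trans hsub)))⟩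
  linarith

/-! ### Logarithms and lifts through the cosine -/

/-- A nonvanishing holomorphic function on a disk has a holomorphic logarithm. -/
theorem exists_differentiableOn_exp_eq {g : ℂ → ℂ} {r : ℝ} (hr : 0 < r)
    (hg : DifferentiableOn ℂ g (ball 0 r)) (h0 : ∀ z ∈ ball 0 r, g z ≠ 0) :
    ∃ L : ℂ → ℂ, DifferentiableOn ℂ L (ball 0 r) ∧ ∀ z ∈ ball 0 r, Complex.exp (L z) = g z := by
  have hex : Complex.IsExactOn (fun z => deriv g z / g z) (ball 0 r) :=
    DifferentiableOn.isExactOn_ball ((hg.deriv isOpen_ball).div hg h0)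
  obtain ⟨L, hL0, hL⟩ := hex.with_val_at 0 (Complex.log (g 0))
  refine ⟨L, fun z hz => (hL z hz).differentiableAt.differentiableWithinAt, ?_⟩
  have hder : ∀ z ∈ ball (0 : ℂ) r, HasDerivAt (fun z => Complex.exp (-L z) * g z) 0 z := by
    intro z hz
    have h := (((hL z hz).fun_neg).cexp).fun_mul
      (hg.differentiableAt (isOpen_ball.mem_nhds hz)).hasDerivAt
    rwa [mul_assoc, neg_mul, div_mul_cancel₀ _ (h0 z hz), mul_neg, neg_add_cancel] at h
  intro z hz
  have hm : (0 : ℂ) ∈ ball (0 : ℂ) r := mem_ball_self hr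
  have hconst := (convex_ball (0 : ℂ) r).norm_image_sub_le_of_norm_hasDerivWithin_le
    (C := 0) (fun x hx => (hder x hx).hasDerivWithinAt) (by simp) hm hz
  rw [zero_mul, norm_le_zero_iff, sub_eq_zero, hL0, Complex.exp_neg, Complex.exp_neg,
    Complex.exp_log (h0 0 hm), inv_mul_cancel₀ (h0 0 hm)] at hconst
  have := Complex.exp_ne_zero (L z)
  field_simp at hconst
  exact hconst.symm

/-- A holomorphic function on the unit disk which omits `1` and `-1` lifts through
`z ↦ cos (π z)`. -/
theorem exists_differentiableOn_cos_eq {F : ℂ → ℂ} (hF : DifferentiableOn ℂ F (ball 0 1))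
    (h1 : ∀ z ∈ ball 0 1, F z ≠ 1) (h2 : ∀ z ∈ ball 0 1, F z ≠ -1) :
    ∃ H : ℂ → ℂ, DifferentiableOn ℂ H (ball 0 1) ∧
      ∀ z ∈ ball 0 1, Complex.cos (Real.pi * H z) = F z := by
  obtain ⟨S, hS, hSe⟩ := exists_differentiableOn_exp_eq one_pos
    (g := fun z => F z ^ 2 - 1) (by fun_prop) (by
      intro z hz h
      have h3 : (F z - 1) * (F z + 1) = 0 := by linear_combination h
      rcases mul_eq_zero.mp h3 with h | h
      · exact h1 z hz (sub_eq_zero.mp h)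
      · exact h2 z hz (eq_neg_of_add_eq_zero_left h))
  have hsq : ∀ z ∈ ball (0 : ℂ) 1, Complex.exp (S z / 2) ^ 2 = F z ^ 2 - 1 := by
    intro z hz
    rw [← hSe z hz, ← Complex.exp_nat_mul]
    congr 1
    push_cast
    ring
  -- With s = exp (S/2) a square root of F² - 1, the factors F ± s are mutually inverse. So if L is
  -- a logarithm of F + s, then -L is one of F - s, and cos (L/i) is half their sum, F.
  have hmul : ∀ z ∈ ball (0 : ℂ) 1,
      (F z + Complex.exp (S z / 2)) * (F z - Complex.exp (S z / 2)) = 1 := fun z hz => by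
    linear_combination -hsq z hz
  obtain ⟨L, hL, hLe⟩ := exists_differentiableOn_exp_eq one_pos
    (g := fun z => F z + Complex.exp (S z / 2)) (by fun_prop) (by
      intro z hz h
      have := hmul z hz
      rw [h, zero_mul] at this
      exact zero_ne_one this)
  refine ⟨fun z => L z / (Real.pi * Complex.I), by fun_prop, fun z hz => ?_⟩
  have hpi : (Real.pi : ℂ) ≠ 0 := by exact_mod_cast Real.pi_ne_zero
  have h3 : (Real.pi : ℂ) * (L z / (Real.pi * Complex.I)) * Complex.I = L z := by
    field_simp
  have h4 : Complex.exp (-L z) = F z - Complex.exp (S z / 2) := by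
    rw [Complex.exp_neg, hLe z hz]
    exact inv_eq_of_mul_eq_one_right (hmul z hz)
  rw [Complex.cos, neg_mul, h3, h4, hLe z hz]
  ring

/-- The points `v` at which `cos (π v)` is an integer meet every disk of radius `2`. -/
theorem exists_cos_pi_mul_eq_int (w : ℂ) :
    ∃ v ∈ ball w 2, ∃ n : ℤ, Complex.cos (Real.pi * v) = n := by
  have hpi := Real.pi_gt_three
  have hcont : Continuous fun y : ℝ => Real.cosh (Real.pi * y) :=
    Real.continuous_cosh.comp (continuous_const.mul continuous_id)
  set y := |w.im| with hy
  have hy0 : 0 ≤ y := abs_nonneg _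
  -- As cosh π ≥ 2, the function cosh (π y) grows by at least 1 over a unit interval in y ≥ 0, hence
  -- takes an integer value there.
  have hle : (⌈Real.cosh (Real.pi * y)⌉ : ℝ) ∈
      Icc (Real.cosh (Real.pi * y)) (Real.cosh (Real.pi * (y + 1))) := by
    refine ⟨Int.le_ceil _, (Int.ceil_lt_add_one _).le.trans ?_⟩
    have h1 : Real.cosh (Real.pi * (y + 1)) = Real.cosh (Real.pi * y) * Real.cosh Real.pi
        + Real.sinh (Real.pi * y) * Real.sinh Real.pi := by
      rw [mul_add, mul_one, Real.cosh_add]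
    have h2 : 2 ≤ Real.cosh Real.pi := by
      rw [Real.cosh_eq]
      have := Real.add_one_le_exp Real.pi
      have := Real.exp_pos (-Real.pi)
      linarith
    have h3 : 0 ≤ Real.sinh (Real.pi * y) * Real.sinh Real.pi :=
      mul_nonneg (Real.sinh_nonneg_iff.mpr (by positivity)) (Real.sinh_nonneg_iff.mpr (by positivity))
    have h4 := Real.one_le_cosh (Real.pi * y)
    nlinarith
  obtain ⟨y', ⟨hy1, hy2⟩, hy'⟩ := intermediate_value_Icc (by linarith) hcont.continuousOn hle
  change Real.cosh (Real.pi * y') = _ at hy'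
  obtain ⟨s, hs, hsw⟩ : ∃ s : ℝ, |s - w.im| ≤ 1 ∧ Real.cosh (Real.pi * s) = Real.cosh (Real.pi * y') := by
    rcases abs_cases w.im with ⟨h, -⟩ | ⟨h, -⟩
    · refine ⟨y', abs_le.mpr ⟨by linarith, by linarith⟩, rfl⟩
    · refine ⟨-y', abs_le.mpr ⟨by linarith, by linarith⟩, ?_⟩
      rw [mul_neg, Real.cosh_neg]
  -- For an integer n, cos (π (n + i s)) = (-1)ⁿ cosh (π s). The distance to `w` is at most 1/2 + 1.
  refine ⟨⟨round w.re, s⟩, ?_, Int.negOnePow (round w.re) * ⌈Real.cosh (Real.pi * y)⌉, ?_⟩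
  · rw [mem_ball, dist_eq_norm]
    refine (Complex.norm_le_abs_re_add_abs_im _).trans_lt ?_
    have := abs_sub_round w.re
    rw [abs_sub_comm] at this
    simp only [Complex.sub_re, Complex.sub_im]
    linarith
  · have h1 : (Real.pi : ℂ) * (⟨round w.re, s⟩ : ℂ) =
        ((round w.re : ℤ) : ℂ) * Real.pi + ((Real.pi * s : ℝ) : ℂ) * Complex.I := by
      apply Complex.ext <;> simp [mul_comm]
    have h2 : Complex.cos (((round w.re : ℤ) : ℂ) * Real.pi) = Int.negOnePow (round w.re) := by
      have := Real.cos_int_mul_pi (round w.re)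
      rw [← Complex.ofReal_intCast, ← Complex.ofReal_mul, ← Complex.ofReal_cos, this]
      rcases Int.even_or_odd (round w.re) with h | h
      · simp [h.neg_one_zpow, Int.negOnePow_even _ h]
      · simp [h.neg_one_zpow, Int.negOnePow_odd _ h]
    rw [h1, Complex.cos_add, Complex.sin_int_mul_pi, h2, Complex.cos_mul_I, ← Complex.ofReal_cosh,
      hsw, hy']
    push_cast
    ring

/-! ### Quantitative Landau theorem -/

/-- The growth of the bound on the derivative at `0` of holomorphic functions on the unit disk which
omit `0` and `1`. -/
noncomputable def landauBound (q : ℂ) : ℝ := 8000 * (1 + ‖q‖) * Real.log (4 + ‖q‖ ^ 2)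

theorem one_le_log_four_add_sq (x : ℝ) : 1 ≤ Real.log (4 + x ^ 2) := by
  rw [Real.le_log_iff_exp_le (by positivity)]
  have := Real.exp_one_lt_d9
  nlinarith [sq_nonneg x]

theorem landauBound_pos (q : ℂ) : 0 < landauBound q := by
  have := one_le_log_four_add_sq ‖q‖
  unfold landauBound
  positivity

theorem norm_sin_le_one_add_norm_cos (w : ℂ) : ‖Complex.sin w‖ ≤ 1 + ‖Complex.cos w‖ := by
  have h1 : ‖Complex.sin w‖ ^ 2 ≤ 1 + ‖Complex.cos w‖ ^ 2 := by
    have h2 : Complex.sin w ^ 2 = 1 - Complex.cos w ^ 2 := by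
      linear_combination Complex.sin_sq_add_cos_sq w
    rw [← norm_pow, h2]
    refine (norm_sub_le _ _).trans_eq ?_
    rw [norm_one, norm_pow]
  refine abs_le_of_sq_le_sq' ?_ (by positivity) |>.2
  nlinarith [norm_nonneg (Complex.cos w)]

theorem exp_abs_im_le (w : ℂ) : Real.exp |w.im| ≤ 1 + 2 * ‖Complex.cos w‖ := by
  have h1 : 2 * ‖Complex.cos w‖ = ‖Complex.exp (w * Complex.I) + Complex.exp (-w * Complex.I)‖ := by
    rw [← Complex.two_cos, norm_mul, Complex.norm_ofNat]
  have h2 : ‖Complex.exp (w * Complex.I)‖ = Real.exp (-w.im) := by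
    rw [Complex.norm_exp]; simp
  have h3 : ‖Complex.exp (-w * Complex.I)‖ = Real.exp w.im := by
    rw [Complex.norm_exp]; simp
  rw [h1]
  rcases abs_cases w.im with ⟨h, h'⟩ | ⟨h, h'⟩
  · have h4 := norm_le_norm_add_norm_sub' (Complex.exp (-w * Complex.I)) (-Complex.exp (w * Complex.I))
    rw [norm_neg, sub_neg_eq_add, h2, h3, add_comm (Complex.exp (-w * Complex.I))] at h4
    have : Real.exp (-w.im) ≤ 1 := Real.exp_le_one_iff.mpr (by linarith)
    rw [h]; linarith
  · have h4 := norm_le_norm_add_norm_sub' (Complex.exp (w * Complex.I)) (-Complex.exp (-w * Complex.I))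
    rw [norm_neg, sub_neg_eq_add, h2, h3] at h4
    have : Real.exp (w.im) ≤ 1 := Real.exp_le_one_iff.mpr (by linarith)
    rw [h]; linarith

/-- If the image of `G` contains no point `v` with `cos (π v)` an integer, then `|G'(0)| ≤ 192`. -/
theorem norm_deriv_le_of_cos_ne_int {G : ℂ → ℂ} (hG : DifferentiableOn ℂ G (ball 0 1))
    (h : ∀ z ∈ ball 0 1, ∀ n : ℤ, Complex.cos (Real.pi * G z) ≠ n) : ‖deriv G 0‖ ≤ 192 := by
  by_contra! hlt
  -- 192 = 2 · 96: the Bloch disk would have radius greater than 2.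
  obtain ⟨w, hw⟩ := exists_ball_subset_image hG (norm_pos_iff.mp (by linarith))
  obtain ⟨v, hv, n, hn⟩ := exists_cos_pi_mul_eq_int w
  obtain ⟨z, hz, rfl⟩ := hw (ball_subset_ball (by linarith) hv)
  exact h z hz n hn

/-- A quantitative form of Landau's theorem. -/
theorem norm_deriv_zero_le_landauBound {f : ℂ → ℂ} (hf : f ∈ holMaps (ball 0 1) {0, 1}ᶜ) :
    ‖deriv f 0‖ ≤ landauBound (f 0) := by
  obtain ⟨hd, hm⟩ := hf
  have hm0 : (0 : ℂ) ∈ ball (0 : ℂ) 1 := mem_ball_self one_pos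
  obtain ⟨H₁, hH₁, hc₁⟩ := exists_differentiableOn_cos_eq (F := fun z => 2 * f z - 1) (by fun_prop)
    (fun z hz h => hm hz (Or.inr (show f z = 1 by linear_combination h / 2)))
    (fun z hz h => hm hz (Or.inl (show f z = 0 by linear_combination h / 2)))
  -- Subtracting an even integer, a period of cos (π ·), normalizes the real part at 0; only the
  -- imaginary part remains to be estimated.
  obtain ⟨H, hH, hc, hre⟩ : ∃ H : ℂ → ℂ, DifferentiableOn ℂ H (ball 0 1) ∧
      (∀ z ∈ ball 0 1, Complex.cos (Real.pi * H z) = 2 * f z - 1) ∧ |(H 0).re| ≤ 1 := by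
    set k := round ((H₁ 0).re / 2)
    refine ⟨fun z => H₁ z - 2 * k, by fun_prop, fun z hz => ?_, ?_⟩
    · rw [← hc₁ z hz]
      refine Eq.trans ?_ (Complex.cos_sub_int_mul_two_pi _ k)
      congr 1
      ring
    · have h1 := abs_sub_round ((H₁ 0).re / 2)
      rw [abs_le] at h1 ⊢
      simp only [Complex.sub_re, Complex.mul_re, Complex.re_ofNat, Complex.intCast_re,
        Complex.im_ofNat, zero_mul, sub_zero]
      exact ⟨by linarith [h1.1], by linarith [h1.2]⟩
  have hint : ∀ z ∈ ball (0 : ℂ) 1, ∀ n : ℤ, H z ≠ n := by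
    intro z hz n hn
    have h1 : Complex.sin (Real.pi * H z) = 0 := by
      rw [hn, mul_comm]
      exact Complex.sin_int_mul_pi n
    have h2 := Complex.sin_sq_add_cos_sq (Real.pi * H z)
    rw [h1, hc z hz] at h2
    have h3 : f z * (f z - 1) = 0 := by linear_combination h2 / 4
    rcases mul_eq_zero.mp h3 with h | h
    · exact hm hz (Or.inl h)
    · exact hm hz (Or.inr (sub_eq_zero.mp h))
  obtain ⟨G, hG, hGc⟩ := exists_differentiableOn_cos_eq hH
    (fun z hz h => hint z hz 1 (by simpa using h)) (fun z hz h => hint z hz (-1) (by simpa using h))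
  have hG192 := norm_deriv_le_of_cos_ne_int hG fun z hz n h => hint z hz n (by rw [← hGc z hz, h])
  have hnhds : ball (0 : ℂ) 1 ∈ 𝓝 0 := isOpen_ball.mem_nhds hm0
  have hdG := (hG.differentiableAt hnhds).hasDerivAt
  have hdH : deriv H 0 = -Complex.sin (Real.pi * G 0) * (Real.pi * deriv G 0) := by
    have h1 := (hdG.const_mul (Real.pi : ℂ)).ccos
    refine (h1.congr_of_eventuallyEq ?_).deriv
    filter_upwards [hnhds] with z hz using (hGc z hz).symm
  have hdf : deriv f 0 = -Complex.sin (Real.pi * H 0) * (Real.pi * deriv H 0) / 2 := by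
    have h1 := ((((hH.differentiableAt hnhds).hasDerivAt.const_mul
      (Real.pi : ℂ)).ccos).const_add 1).div_const 2
    refine (h1.congr_of_eventuallyEq ?_).deriv
    filter_upwards [hnhds] with z hz
    rw [hc z hz]
    ring
  have hF0 : ‖2 * f 0 - 1‖ ≤ 1 + 2 * ‖f 0‖ := by
    have := norm_sub_le (2 * f 0) 1
    rw [norm_mul, Complex.norm_ofNat, norm_one] at this
    linarith
  set L := Real.log (4 + ‖f 0‖ ^ 2) with hL
  have hL1 : 1 ≤ L := one_le_log_four_add_sq _
  -- The lift is only logarithmically large: exp (π |Im H(0)|) is bounded by a multiple of 1 +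
  -- |f(0)|, hence by (4 + |f(0)|²)².
  have hH0 : ‖H 0‖ ≤ 1 + 2 * L := by
    have h1 := exp_abs_im_le (Real.pi * H 0)
    rw [hc 0 hm0, Complex.im_ofReal_mul, abs_mul, abs_of_pos Real.pi_pos] at h1
    have h2 : Real.exp (Real.pi * |(H 0).im|) ≤ Real.exp (2 * L) := by
      have h3 : Real.exp (2 * L) = (4 + ‖f 0‖ ^ 2) ^ 2 := by
        rw [two_mul, Real.exp_add, hL, Real.exp_log (by positivity)]
        ring
      rw [h3]
      nlinarith [sq_nonneg (‖f 0‖ - 1), norm_nonneg (f 0), sq_nonneg (‖f 0‖ ^ 2)]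
    have h4 := Real.exp_le_exp.mp h2
    have h5 : |(H 0).im| ≤ Real.pi * |(H 0).im| :=
      le_mul_of_one_le_left (abs_nonneg _) (by linarith [Real.pi_gt_three])
    linarith [Complex.norm_le_abs_re_add_abs_im (H 0)]
  have hs1 : ‖Complex.sin (Real.pi * G 0)‖ ≤ 4 * L := by
    have := norm_sin_le_one_add_norm_cos (Real.pi * G 0)
    rw [hGc 0 hm0] at this
    linarith
  have hs2 : ‖Complex.sin (Real.pi * H 0)‖ ≤ 2 * (1 + ‖f 0‖) := by
    have := norm_sin_le_one_add_norm_cos (Real.pi * H 0)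
    rw [hc 0 hm0] at this
    linarith
  have hpi4 : Real.pi ≤ 3.2 := by linarith [Real.pi_lt_d2]
  rw [hdf, hdH]
  simp only [norm_div, norm_mul, norm_neg, Complex.norm_real, Complex.norm_ofNat,
    Real.norm_of_nonneg Real.pi_pos.le]
  -- The outer sine contributes 1 + |f(0)|, the inner one the logarithm.
  calc ‖Complex.sin (Real.pi * H 0)‖ * (Real.pi * (‖Complex.sin (Real.pi * G 0)‖ *
        (Real.pi * ‖deriv G 0‖))) / 2
      ≤ 2 * (1 + ‖f 0‖) * (3.2 * (4 * L * (3.2 * 192))) / 2 := by gcongr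
    _ = 7864.32 * ((1 + ‖f 0‖) * L) := by ring
    _ ≤ 8000 * ((1 + ‖f 0‖) * L) := by gcongr; norm_num
    _ = landauBound (f 0) := by rw [landauBound, ← hL]; ring

/-- Landau's estimate at 0, applied after rescaling the disk of radius 1 - |z| about `z`. -/
theorem norm_deriv_mul_le_landauBound {f : ℂ → ℂ} (hf : f ∈ holMaps (ball 0 1) {0, 1}ᶜ)
    {z : ℂ} (hz : z ∈ ball (0 : ℂ) 1) : ‖deriv f z‖ * (1 - ‖z‖) ≤ landauBound (f z) := by
  have hz1 : ‖z‖ < 1 := by simpa using hz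
  have hs : 0 < 1 - ‖z‖ := by linarith
  have hmaps : MapsTo (fun ζ : ℂ => z + ((1 - ‖z‖ : ℝ) : ℂ) * ζ) (ball 0 1) (ball 0 1) := by
    intro ζ hζ
    rw [mem_ball_zero_iff] at hζ ⊢
    refine (norm_add_le _ _).trans_lt ?_
    rw [norm_mul, Complex.norm_real, Real.norm_of_nonneg hs.le]
    nlinarith
  have h := norm_deriv_zero_le_landauBound (f := fun ζ => f (z + ((1 - ‖z‖ : ℝ) : ℂ) * ζ))
    ⟨hf.1.comp (by fun_prop) hmaps, fun ζ hζ => hf.2 (hmaps hζ)⟩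
  have hfz := (hf.1.differentiableAt (isOpen_ball.mem_nhds hz)).hasDerivAt
  have hd : HasDerivAt (fun ζ => f (z + ((1 - ‖z‖ : ℝ) : ℂ) * ζ))
      (deriv f z * (1 - ‖z‖ : ℝ)) 0 := by
    have h1 : HasDerivAt (fun ζ : ℂ => z + ((1 - ‖z‖ : ℝ) : ℂ) * ζ) ((1 - ‖z‖ : ℝ) : ℂ) 0 := by
      simpa using ((hasDerivAt_id (0 : ℂ)).const_mul ((1 - ‖z‖ : ℝ) : ℂ)).const_add z
    refine HasDerivAt.comp (0 : ℂ) ?_ h1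
    simpa using hfz
  rw [hd.deriv, norm_mul, Complex.norm_real, Real.norm_of_nonneg hs.le] at h
  simpa using h

/-! ### Lipschitz functions and lower bounds for the Kobayashi pseudodistance -/

/-- A real function whose gradient is controlled by the reciprocal of `landauBound` varies slowly
along holomorphic disks that omit `0` and `1`. -/
theorem abs_sub_le_neg_log {f : ℂ → ℂ} (hf : f ∈ holMaps (ball 0 1) {0, 1}ᶜ)
    {ψ : ℂ → ℝ} {ψ' : ℂ → ℂ →L[ℝ] ℝ} {K : ℝ} (hψ : ∀ q, HasFDerivAt ψ (ψ' q) q)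
    (hK : ∀ q, ‖ψ' q‖ * landauBound q ≤ K) {c : ℂ} (hc : c ∈ ball (0 : ℂ) 1) :
    |ψ (f c) - ψ (f 0)| ≤ K * -Real.log (1 - ‖c‖) := by
  have hc1 : ‖c‖ < 1 := by simpa using hc
  have hmem : ∀ s ∈ Icc (0 : ℝ) 1, (s : ℂ) * c ∈ ball (0 : ℂ) 1 := by
    intro s hs
    rw [mem_ball_zero_iff, norm_mul, Complex.norm_real, Real.norm_of_nonneg hs.1]
    nlinarith [norm_nonneg c, hs.2]
  have hpos : ∀ s ∈ Icc (0 : ℝ) 1, 0 < 1 - s * ‖c‖ := by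
    intro s hs
    nlinarith [norm_nonneg c, hs.2]
  have hder : ∀ s ∈ Icc (0 : ℝ) 1, HasDerivAt (fun s : ℝ => ψ (f (s * c)) - ψ (f 0))
      (ψ' (f (s * c)) (deriv f (s * c) * c)) s := by
    intro s hs
    have h1 := (hf.1.differentiableAt (isOpen_ball.mem_nhds (hmem s hs))).hasDerivAt
    have h2 : HasDerivAt (fun s : ℂ => s * c) c (s : ℂ) := by
      simpa using (hasDerivAt_id (s : ℂ)).mul_const c
    have h3 := (HasDerivAt.comp (s : ℂ) h1 h2).comp_ofReal
    exact ((hψ _).comp_hasDerivAt s h3).sub_const _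
  have hB : ∀ s ∈ Icc (0 : ℝ) 1, HasDerivAt (fun s : ℝ => K * -Real.log (1 - s * ‖c‖))
      (K * (‖c‖ / (1 - s * ‖c‖))) s := by
    intro s hs
    have h1 : HasDerivAt (fun s : ℝ => 1 - s * ‖c‖) (-‖c‖) s := by
      simpa using ((hasDerivAt_id s).mul_const ‖c‖).const_sub 1
    have h2 := ((h1.log (hpos s hs).ne').fun_neg).const_mul K
    rwa [neg_div, neg_neg] at h2
  -- Along the segment s ↦ s c, the derivative of ψ ∘ f is dominated by that of -K log (1 - s |c|).
  have h := image_norm_le_of_norm_deriv_right_le_deriv_boundary' (a := 0) (b := 1)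
    (fun s hs => (hder s hs).continuousAt.continuousWithinAt)
    (fun s hs => (hder s (Ico_subset_Icc_self hs)).hasDerivWithinAt) (by simp)
    (fun s hs => (hB s hs).continuousAt.continuousWithinAt)
    (fun s hs => (hB s (Ico_subset_Icc_self hs)).hasDerivWithinAt) (by
      intro s hs
      have hs' := Ico_subset_Icc_self hs
      have h1 := norm_deriv_mul_le_landauBound hf (hmem s hs')
      rw [norm_mul, Complex.norm_real, Real.norm_of_nonneg hs.1] at h1
      rw [mul_div_assoc', le_div_iff₀ (hpos s hs')]
      calc ‖ψ' (f (s * c)) (deriv f (s * c) * c)‖ * (1 - s * ‖c‖)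
          ≤ ‖ψ' (f (s * c))‖ * (‖deriv f (s * c)‖ * ‖c‖) * (1 - s * ‖c‖) := by
            have := hpos s hs'
            gcongr
            exact (ContinuousLinearMap.le_opNorm _ _).trans_eq (by rw [norm_mul])
        _ = ‖ψ' (f (s * c))‖ * (‖deriv f (s * c)‖ * (1 - s * ‖c‖)) * ‖c‖ := by ring
        _ ≤ ‖ψ' (f (s * c))‖ * landauBound (f (s * c)) * ‖c‖ := by gcongr
        _ ≤ K * ‖c‖ := by gcongr; exact hK _)
  simpa using h (right_mem_Icc.mpr zero_le_one)

/-- The identity which shows that the Möbius map (ζ + a) / (1 + ā ζ) preserves the unit disk when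
|a| < 1. -/
theorem normSq_one_add_conj_mul_sub (a ζ : ℂ) :
    ‖1 + conj a * ζ‖ ^ 2 - ‖ζ + a‖ ^ 2 = (1 - ‖a‖ ^ 2) * (1 - ‖ζ‖ ^ 2) := by
  simp only [← Complex.normSq_eq_norm_sq, Complex.normSq_apply, Complex.add_re, Complex.add_im,
    Complex.mul_re, Complex.mul_im, Complex.conj_re, Complex.conj_im, Complex.one_re, Complex.one_im]
  ring

theorem norm_add_lt_norm_one_add_conj_mul {a ζ : ℂ} (ha : a ∈ ball (0 : ℂ) 1)
    (hζ : ζ ∈ ball (0 : ℂ) 1) : ‖ζ + a‖ < ‖1 + conj a * ζ‖ := by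
  rw [mem_ball_zero_iff] at ha hζ
  have h := normSq_one_add_conj_mul_sub a ζ
  have h1 : 0 < (1 - ‖a‖ ^ 2) * (1 - ‖ζ‖ ^ 2) :=
    mul_pos (by nlinarith [norm_nonneg a]) (by nlinarith [norm_nonneg ζ])
  exact lt_of_pow_lt_pow_left₀ 2 (norm_nonneg _) (by linarith)

/-- The pseudohyperbolic distance in the unit disk is less than `1`. -/
theorem norm_div_one_sub_conj_mul_lt_one {a b : ℂ} (ha : a ∈ ball (0 : ℂ) 1)
    (hb : b ∈ ball (0 : ℂ) 1) : ‖(a - b) / (1 - conj b * a)‖ < 1 := by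
  have h := norm_add_lt_norm_one_add_conj_mul (a := -b) (ζ := a) (by simpa using hb) ha
  rw [map_neg, neg_mul, ← sub_eq_add_neg, ← sub_eq_add_neg] at h
  rw [norm_div, div_lt_one ((norm_nonneg _).trans_lt h)]
  exact h

theorem neg_log_one_sub_le {t : ℝ} (h0 : 0 ≤ t) (h1 : t < 1) :
    -Real.log (1 - t) ≤ 2 * (1 / 2 * Real.log ((1 + t) / (1 - t))) := by
  rw [Real.log_div (by linarith) (by linarith)]
  have := Real.log_nonneg (show (1 : ℝ) ≤ 1 + t by linarith)
  linarith

theorem poincareDist_nonneg {a b : ℂ} (ha : a ∈ ball (0 : ℂ) 1) (hb : b ∈ ball (0 : ℂ) 1) :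
    0 ≤ poincareDist a b := by
  have h := norm_div_one_sub_conj_mul_lt_one ha hb
  have h1 := neg_log_one_sub_le (norm_nonneg _) h
  have h2 := Real.log_nonpos (sub_nonneg.mpr h.le) (sub_le_self 1 (norm_nonneg _))
  unfold poincareDist
  linarith

/-- `ψ` is `K`-Lipschitz along all holomorphic disks in `D`. -/
def LipschitzOnDisks (D : Set ℂ) (ψ : ℂ → ℝ) (K : ℝ) : Prop :=
  ∀ f ∈ holMaps (ball 0 1) D, ∀ a ∈ ball (0 : ℂ) 1, ∀ b ∈ ball (0 : ℂ) 1,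
    |ψ (f a) - ψ (f b)| ≤ K * poincareDist a b

/-- A disk automorphism moves `b` to 0 and reduces to the radial estimate; the factor 2 is the price
of replacing -log (1 - |c|) by the Poincaré distance. -/
theorem lipschitzOnDisks_of_fderiv {ψ : ℂ → ℝ} {ψ' : ℂ → ℂ →L[ℝ] ℝ} {K : ℝ}
    (hψ : ∀ q, HasFDerivAt ψ (ψ' q) q) (hK : ∀ q, ‖ψ' q‖ * landauBound q ≤ K) :
    LipschitzOnDisks {0, 1}ᶜ ψ (2 * K) := by
  intro f hf a ha b hb
  have hK0 : 0 ≤ K := (mul_nonneg (norm_nonneg _) (landauBound_pos 0).le).trans (hK 0)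
  have hne : ∀ ζ ∈ ball (0 : ℂ) 1, 1 + conj b * ζ ≠ 0 := fun ζ hζ =>
    norm_pos_iff.mp ((norm_nonneg _).trans_lt (norm_add_lt_norm_one_add_conj_mul hb hζ))
  have hmaps : MapsTo (fun ζ => (ζ + b) / (1 + conj b * ζ)) (ball 0 1) (ball 0 1) := by
    intro ζ hζ
    rw [mem_ball_zero_iff, norm_div, div_lt_one (norm_pos_iff.mpr (hne ζ hζ))]
    exact norm_add_lt_norm_one_add_conj_mul hb hζ
  set c := (a - b) / (1 - conj b * a) with hc
  have hcb : ‖c‖ < 1 := norm_div_one_sub_conj_mul_lt_one ha hb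
  have hc1 : c ∈ ball (0 : ℂ) 1 := by simpa using hcb
  have hd : 1 - conj b * a ≠ 0 := by
    simpa [sub_eq_add_neg] using
      norm_pos_iff.mp ((norm_nonneg _).trans_lt (norm_add_lt_norm_one_add_conj_mul (a := -b) (ζ := a)
        (by simpa using hb) ha))
  have hca : (c + b) / (1 + conj b * c) = a := by
    have h1 : c * (1 - conj b * a) = a - b := div_mul_cancel₀ _ hd
    rw [div_eq_iff (hne c hc1)]
    linear_combination h1
  have h := abs_sub_le_neg_log (f := fun ζ => f ((ζ + b) / (1 + conj b * ζ)))
    ⟨hf.1.comp (by fun_prop (disch := exact hne)) hmaps, fun ζ hζ => hf.2 (hmaps hζ)⟩ hψ hK hc1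
  simp only [hca, zero_add, mul_zero, add_zero, div_one] at h
  refine h.trans ?_
  rw [mul_comm 2 K, mul_assoc]
  exact mul_le_mul_of_nonneg_left (neg_log_one_sub_le (norm_nonneg c) hcb) hK0

theorem LipschitzOnDisks.comp {D E : Set ℂ} {ψ : ℂ → ℝ} {K : ℝ} (h : LipschitzOnDisks E ψ K)
    {m : ℂ → ℂ} (hd : DifferentiableOn ℂ m D) (hm : MapsTo m D E) :
    LipschitzOnDisks D (fun z => ψ (m z)) K := fun f hf a ha b hb =>
  h (fun z => m (f z)) ⟨hd.comp hf.1 hf.2, fun _ hz => hm (hf.2 hz)⟩ a ha b hb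

/-- Telescoping along a chain of length below `d`. -/
theorem LipschitzOnDisks.abs_sub_le {D : Set ℂ} {ψ : ℂ → ℝ} {K : ℝ} (h : LipschitzOnDisks D ψ K)
    (hK : 0 ≤ K) {p q : ℂ} {d : ℝ} (hd : kobayashiDist D p q < ENNReal.ofReal d) :
    |ψ p - ψ q| ≤ K * d := by
  obtain ⟨c, hc⟩ := iInf_lt_iff.mp hd
  have hnn : ∀ i ∈ Finset.range c.k, 0 ≤ poincareDist (c.a i) (c.b i) := fun i hi =>
    poincareDist_nonneg (c.a_mem i (Finset.mem_range.mp hi)) (c.b_mem i (Finset.mem_range.mp hi))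
  rw [DiskChain.length, ← ENNReal.ofReal_sum_of_nonneg hnn] at hc
  have hsum : ∑ i ∈ Finset.range c.k, poincareDist (c.a i) (c.b i) ≤ d :=
    (ENNReal.ofReal_lt_ofReal_iff'.mp hc).1.le
  have h1 := dist_le_range_sum_dist (fun i => ψ (c.pt i)) c.k
  rw [c.pt_zero, c.pt_last, Real.dist_eq] at h1
  calc |ψ p - ψ q| ≤ ∑ i ∈ Finset.range c.k, dist (ψ (c.pt i)) (ψ (c.pt (i + 1))) := h1
    _ ≤ ∑ i ∈ Finset.range c.k, K * poincareDist (c.a i) (c.b i) := by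
        refine Finset.sum_le_sum fun i hi => ?_
        have hi' := Finset.mem_range.mp hi
        rw [← c.f_a i hi', ← c.f_b i hi', Real.dist_eq]
        exact h _ (c.f_mem i hi') _ (c.a_mem i hi') _ (c.b_mem i hi')
    _ ≤ K * d := by rw [← Finset.mul_sum]; gcongr

/-! ### The two test functions -/

/-- An exhaustion function of the plane which is Lipschitz on holomorphic disks omitting two
points. -/
noncomputable def logLog (q : ℂ) : ℝ := Real.log (Real.log (4 + ‖q‖ ^ 2))

theorem norm_le_of_logLog_le {q : ℂ} {T : ℝ} (h : logLog q ≤ T) : ‖q‖ ≤ Real.exp (Real.exp T) := by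
  have h1 := one_le_log_four_add_sq ‖q‖
  have h2 : 4 + ‖q‖ ^ 2 ≤ Real.exp (Real.exp T) := by
    rw [← Real.log_le_iff_le_exp (by positivity), ← Real.log_le_iff_le_exp (by linarith)]
    exact h
  nlinarith [sq_nonneg (‖q‖ - 1)]

theorem continuous_logLog : Continuous logLog := by
  unfold logLog
  refine Continuous.log (Continuous.log (by fun_prop) fun q => ?_) fun q => ?_
  · positivity
  · linarith [one_le_log_four_add_sq ‖q‖]

/-- The gradient has norm 2|q| / ((4 + |q|²) log (4 + |q|²)). Against `landauBound` the logarithms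
cancel and a bounded rational function of |q| remains. -/
theorem lipschitzOnDisks_logLog : LipschitzOnDisks {0, 1}ᶜ logLog 64000 := by
  have hder : ∀ q : ℂ, HasFDerivAt logLog
      ((Real.log (4 + ‖q‖ ^ 2))⁻¹ • ((4 + ‖q‖ ^ 2)⁻¹ • (2 • innerSL ℝ q))) q := by
    intro q
    have h1 : HasFDerivAt (fun q : ℂ => 4 + ‖q‖ ^ 2) (2 • innerSL ℝ q) q :=
      (hasStrictFDerivAt_norm_sq q).hasFDerivAt.const_add 4
    exact (h1.log (by positivity)).log (by linarith [one_le_log_four_add_sq ‖q‖])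
  have := lipschitzOnDisks_of_fderiv hder (K := 32000) (by
    intro q
    have h1 := one_le_log_four_add_sq ‖q‖
    set L := Real.log (4 + ‖q‖ ^ 2) with hL
    rw [two_smul, ← two_smul ℝ (innerSL ℝ q), norm_smul, norm_smul, norm_smul, innerSL_apply_norm,
      landauBound, ← hL, norm_inv, norm_inv, Real.norm_of_nonneg (by linarith),
      Real.norm_of_nonneg (by positivity), Real.norm_of_nonneg (by norm_num)]
    have h2 : L⁻¹ * ((4 + ‖q‖ ^ 2)⁻¹ * (2 * ‖q‖)) * (8000 * (1 + ‖q‖) * L) =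
        16000 * (‖q‖ * (1 + ‖q‖)) / (4 + ‖q‖ ^ 2) := by
      field_simp
      ring
    rw [h2, div_le_iff₀ (by positivity)]
    nlinarith [sq_nonneg (‖q‖ - 1)])
  norm_num at this
  exact this

/-- A bounded function that separates `p` from all other points. -/
noncomputable def sep (p q : ℂ) : ℝ := 1 - (1 + ‖q - p‖ ^ 2)⁻¹

/-- A Lipschitz constant on holomorphic disks for `sep p`, depending on `‖p‖`. -/
noncomputable def sepConst (P : ℝ) : ℝ := 32000 * ((2 + P) * (3 + 2 * P ^ 2))

/-- With t = |q - p|, the gradient decays like t⁻³, so even the crude log x ≤ x - 1 in `landauBound`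
is affordable. That the constant depends only on a bound for |p| makes later estimates uniform on
bounded sets. -/
theorem lipschitzOnDisks_sep {p : ℂ} {P : ℝ} (hp : ‖p‖ ≤ P) :
    LipschitzOnDisks {0, 1}ᶜ (sep p) (sepConst P) := by
  have hP : 0 ≤ P := (norm_nonneg p).trans hp
  have hder : ∀ q : ℂ, HasFDerivAt (sep p)
      (((1 + ‖q - p‖ ^ 2) ^ 2)⁻¹ • (2 • innerSL ℝ (q - p))) q := by
    intro q
    have h1 : HasFDerivAt (fun q : ℂ => 1 + ‖q - p‖ ^ 2) (2 • innerSL ℝ (q - p)) q := by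
      have h2 := ((hasStrictFDerivAt_norm_sq (q - p)).hasFDerivAt.comp q
        ((hasFDerivAt_id q).sub_const p)).const_add 1
      simpa using h2
    have h3 := ((hasDerivAt_inv (x := 1 + ‖q - p‖ ^ 2) (by positivity)).comp_hasFDerivAt q
      h1).const_sub 1
    rwa [← neg_smul, neg_neg] at h3
  have := lipschitzOnDisks_of_fderiv hder (K := sepConst P / 2) (by
    intro q
    set t := ‖q - p‖ with ht
    have ht0 : 0 ≤ t := norm_nonneg _
    have hq : ‖q‖ ≤ P + t := (norm_le_norm_add_norm_sub' q p).trans (by gcongr)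
    have hlog : Real.log (4 + ‖q‖ ^ 2) ≤ 3 + 2 * P ^ 2 + 2 * t ^ 2 := by
      have h1 := Real.log_le_sub_one_of_pos (show 0 < 4 + ‖q‖ ^ 2 by positivity)
      have h2 : ‖q‖ ^ 2 ≤ (P + t) ^ 2 := by gcongr
      nlinarith [sq_nonneg (P - t)]
    rw [two_smul, ← two_smul ℝ (innerSL ℝ (q - p)), norm_smul, norm_smul, innerSL_apply_norm,
      landauBound, norm_inv, Real.norm_of_nonneg (by positivity),
      Real.norm_of_nonneg (by norm_num), ← ht]
    have hlog0 := one_le_log_four_add_sq ‖q‖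
    have h1 : t * (1 + P + t) ≤ (2 + P) * (1 + t ^ 2) := by
      nlinarith [sq_nonneg (t - 1), mul_nonneg hP (sq_nonneg (t - 1)), mul_nonneg hP ht0]
    have h2 : 3 + 2 * P ^ 2 + 2 * t ^ 2 ≤ (3 + 2 * P ^ 2) * (1 + t ^ 2) := by
      nlinarith [mul_nonneg (sq_nonneg P) (sq_nonneg t), sq_nonneg t]
    calc ((1 + t ^ 2) ^ 2)⁻¹ * (2 * t) * (8000 * (1 + ‖q‖) * Real.log (4 + ‖q‖ ^ 2))
        ≤ ((1 + t ^ 2) ^ 2)⁻¹ * (2 * t) * (8000 * (1 + (P + t)) * (3 + 2 * P ^ 2 + 2 * t ^ 2)) := by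
          gcongr
      _ = 16000 * ((t * (1 + P + t)) * (3 + 2 * P ^ 2 + 2 * t ^ 2)) / (1 + t ^ 2) ^ 2 := by
          field_simp
          ring
      _ ≤ 16000 * (((2 + P) * (1 + t ^ 2)) * ((3 + 2 * P ^ 2) * (1 + t ^ 2))) / (1 + t ^ 2) ^ 2 := by
          have := mul_le_mul h1 h2 (by positivity) (by positivity)
          gcongr
      _ = sepConst P / 2 := by
          rw [sepConst]
          field_simp
          norm_num)
  rwa [mul_div_cancel₀ _ (two_ne_zero)] at this

theorem lt_of_sep_lt {p q : ℂ} {ε : ℝ} (hε : 0 ≤ ε) (h : sep p q < 1 - (1 + ε ^ 2)⁻¹) :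
    ‖q - p‖ < ε := by
  have h1 : (1 + ε ^ 2)⁻¹ < (1 + ‖q - p‖ ^ 2)⁻¹ := by unfold sep at h; linarith
  rw [inv_lt_inv₀ (by positivity) (by positivity)] at h1
  exact lt_of_pow_lt_pow_left₀ 2 hε (by linarith)

/-! ### Upper bounds for the Kobayashi pseudodistance -/

theorem kobayashiDist_le_poincareDist {D : Set ℂ} {f : ℂ → ℂ} (hf : f ∈ holMaps (ball 0 1) D)
    {a b : ℂ} (ha : a ∈ ball (0 : ℂ) 1) (hb : b ∈ ball (0 : ℂ) 1) :
    kobayashiDist D (f a) (f b) ≤ ENNReal.ofReal (poincareDist a b) := by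
  let c : DiskChain D (f a) (f b) :=
    { k := 1, pt := fun i => if i = 0 then f a else f b, a := fun _ => a, b := fun _ => b
      f := fun _ => f
      one_le := le_rfl, pt_zero := rfl, pt_last := rfl
      a_mem := fun _ _ => ha, b_mem := fun _ _ => hb
      f_mem := fun _ _ => hf
      f_a := fun i hi => by simp [Nat.lt_one_iff.mp hi]
      f_b := fun i hi => by simp }
  exact (iInf_le _ c).trans_eq (by simp [DiskChain.length, c])

theorem poincareDist_zero_left (z : ℂ) :
    poincareDist 0 z = 1 / 2 * Real.log ((1 + ‖z‖) / (1 - ‖z‖)) := by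
  simp [poincareDist]

theorem poincareDist_zero_left_le {z : ℂ} {r : ℝ} (hz : ‖z‖ ≤ r) (hr : r < 1) :
    poincareDist 0 z ≤ 1 / 2 * Real.log ((1 + r) / (1 - r)) := by
  have h0 : 0 ≤ ‖z‖ := norm_nonneg z
  rw [poincareDist_zero_left]
  have h1 : 0 < 1 - ‖z‖ := by linarith
  have h2 : 0 < 1 - r := by linarith
  have h3 : 0 ≤ 1 + r := by linarith
  gcongr

/-- A Euclidean disk about `p` inside D is an affine image of the unit disk and gives one-link
chains of small length. -/
theorem tendsto_kobayashiDist_nhds_zero {D : Set ℂ} (hD : IsOpen D) {p : ℂ} (hp : p ∈ D) :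
    Tendsto (kobayashiDist D p) (𝓝 p) (𝓝 0) := by
  obtain ⟨r, hr, hball⟩ := Metric.isOpen_iff.mp hD p hp
  have hr0 : (r : ℂ) ≠ 0 := by exact_mod_cast hr.ne'
  have hf : (fun ζ : ℂ => p + r * ζ) ∈ holMaps (ball 0 1) D := by
    refine ⟨by fun_prop, fun ζ hζ => hball ?_⟩
    rw [mem_ball_zero_iff] at hζ
    rw [mem_ball, dist_eq_norm, add_sub_cancel_left, norm_mul, Complex.norm_real,
      Real.norm_of_nonneg hr.le]
    nlinarith
  have hω : Tendsto (fun q : ℂ => ENNReal.ofReal (poincareDist 0 ((q - p) / r))) (𝓝 p) (𝓝 0) := by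
    have h : ContinuousAt (fun q : ℂ => ENNReal.ofReal (poincareDist 0 ((q - p) / r))) p := by
      simp only [poincareDist_zero_left]
      refine ENNReal.continuous_ofReal.continuousAt.comp (continuousAt_const.mul
        (ContinuousAt.log (ContinuousAt.div (by fun_prop) (by fun_prop) (by simp)) (by simp)))
    simpa [ContinuousAt, poincareDist] using h
  refine tendsto_of_tendsto_of_tendsto_of_le_of_le' tendsto_const_nhds hω
    (Eventually.of_forall fun _ => bot_le) ?_
  filter_upwards [ball_mem_nhds p hr] with q hq
  have hb : (q - p) / r ∈ ball (0 : ℂ) 1 := by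
    rw [mem_ball_zero_iff, norm_div, Complex.norm_real, Real.norm_of_nonneg hr.le, div_lt_one hr,
      ← dist_eq_norm]
    exact hq
  have h := kobayashiDist_le_poincareDist hf (mem_ball_self one_pos) hb
  simpa [mul_div_cancel₀ _ hr0] using h

/-- Being at finite distance is symmetric, transitive and true locally, so connectedness spreads it
over D. -/
theorem kobayashiDist_ne_top {D : Set ℂ} (hD : IsOpen D) (hc : IsConnected D) {p q : ℂ}
    (hp : p ∈ D) (hq : q ∈ D) : kobayashiDist D p q ≠ ⊤ := by
  refine hc.isPreconnected.induction₂ (fun p q => kobayashiDist D p q ≠ ⊤) (fun x hx => ?_)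
    (fun x y z _ _ _ hxy hyz => ?_) (fun x y _ _ h => ?_) hp hq
  · exact nhdsWithin_le_nhds ((tendsto_kobayashiDist_nhds_zero hD hx).eventually_ne
      ENNReal.zero_ne_top)
  · exact ne_top_of_le_ne_top (ENNReal.add_ne_top.mpr ⟨hxy, hyz⟩) (kobayashiDist_triangle D x y z)
  · rwa [kobayashiDist_comm]

/-! ### Domains omitting two points: hyperbolicity, Landau, Schottky -/

section TwoPoints

variable {D : Set ℂ} {m : ℂ → ℂ}

theorem logLog_le_of_kobayashiDist_lt (hd : DifferentiableOn ℂ m D)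
    (hm : MapsTo m D {0, 1}ᶜ) {p q : ℂ} {d : ℝ} (h : kobayashiDist D p q < ENNReal.ofReal d) :
    logLog (m q) ≤ logLog (m p) + 64000 * d := by
  have h1 := (lipschitzOnDisks_logLog.comp hd hm).abs_sub_le (by norm_num) h
  linarith [(abs_le.mp h1).1]

/-- Since `sep (m p)` vanishes at `m p` and is bounded below at distance ε from it, its uniform
Lipschitz bound yields one δ for all `p` with |m p| ≤ P. -/
theorem exists_forall_norm_sub_lt (hd : DifferentiableOn ℂ m D) (hm : MapsTo m D {0, 1}ᶜ)
    {P ε : ℝ} (hP : 0 ≤ P) (hε : 0 < ε) : ∃ δ > 0, ∀ p q : ℂ, ‖m p‖ ≤ P →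
      kobayashiDist D p q < ENNReal.ofReal δ → ‖m q - m p‖ < ε := by
  have hpos : 0 < 1 - (1 + ε ^ 2)⁻¹ := by
    have : (1 + ε ^ 2)⁻¹ < 1 := inv_lt_one_of_one_lt₀ (by nlinarith)
    linarith
  have hK : 0 < sepConst P := by unfold sepConst; positivity
  refine ⟨(1 - (1 + ε ^ 2)⁻¹) / sepConst P / 2, by positivity, fun p q hp hpq => ?_⟩
  refine lt_of_sep_lt hε.le ?_
  have h1 := ((lipschitzOnDisks_sep hp).comp hd hm).abs_sub_le hK.le hpq
  have h2 : sepConst P * ((1 - (1 + ε ^ 2)⁻¹) / sepConst P / 2) = (1 - (1 + ε ^ 2)⁻¹) / 2 := by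
    field_simp
  have h3 : sep (m p) (m p) = 0 := by simp [sep]
  rw [h2, h3] at h1
  linarith [(abs_le.mp h1).1]

/-- The affine map that sends `z` to `0` and `w` to `1`. -/
noncomputable def affineMap (z w q : ℂ) : ℂ := (q - z) / (w - z)

variable {z w : ℂ}

theorem differentiable_affineMap : Differentiable ℂ (affineMap z w) := by
  unfold affineMap
  fun_prop

theorem mapsTo_affineMap (hz : z ∉ D) (hw : w ∉ D) (hzw : z ≠ w) :
    MapsTo (affineMap z w) D {0, 1}ᶜ := by
  have hwz : w - z ≠ 0 := sub_ne_zero.mpr hzw.symm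
  rintro q hq (h | h)
  · rw [affineMap, div_eq_zero_iff] at h
    exact hz (sub_eq_zero.mp (h.resolve_right hwz) ▸ hq)
  · rw [mem_singleton_iff, affineMap, div_eq_one_iff_eq hwz] at h
    exact hw (sub_left_injective h ▸ hq)

theorem eq_add_mul_affineMap (hzw : z ≠ w) (q : ℂ) : q = z + (w - z) * affineMap z w q := by
  rw [affineMap, mul_div_cancel₀ _ (sub_ne_zero.mpr hzw.symm)]
  ring

theorem norm_le_of_norm_affineMap_le (hzw : z ≠ w) {q : ℂ} {P : ℝ} (h : ‖affineMap z w q‖ ≤ P) :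
    ‖q‖ ≤ ‖z‖ + ‖w - z‖ * P := by
  conv_lhs => rw [eq_add_mul_affineMap hzw q]
  refine (norm_add_le _ _).trans ?_
  rw [norm_mul]
  gcongr

theorem isKobayashiHyperbolic_of_notMem (hD : IsOpen D) (hc : IsConnected D) (hz : z ∉ D)
    (hw : w ∉ D) (hzw : z ≠ w) : IsKobayashiHyperbolic D := by
  refine fun p hp q hq => ⟨kobayashiDist_ne_top hD hc hp hq, fun h0 => ?_⟩
  by_contra hpq
  have hne : 0 < ‖affineMap z w q - affineMap z w p‖ := by
    refine norm_pos_iff.mpr (sub_ne_zero.mpr fun h => hpq ?_)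
    rw [eq_add_mul_affineMap hzw p, eq_add_mul_affineMap hzw q, h]
  obtain ⟨δ, hδ, h⟩ := exists_forall_norm_sub_lt differentiable_affineMap.differentiableOn
    (mapsTo_affineMap hz hw hzw) (norm_nonneg (affineMap z w p)) hne
  exact lt_irrefl _ (h p q le_rfl (by rw [h0]; exact ENNReal.ofReal_pos.mpr hδ))

/-- With m affine, this rules out escape to infinity; with m a Möbius map having its pole at an
omitted point, it rules out convergence to that point. -/
theorem exists_norm_le_of_cauchy (hd : DifferentiableOn ℂ m D) (hm : MapsTo m D {0, 1}ᶜ)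
    {u : ℕ → ℂ} (hu : ∀ ε > 0, ∃ N, ∀ i ≥ N, ∀ j ≥ N, kobayashiDist D (u i) (u j) < ε) :
    ∃ P : ℝ, 0 < P ∧ ∃ N, ∀ i ≥ N, ‖m (u i)‖ ≤ P := by
  obtain ⟨N, hN⟩ := hu (ENNReal.ofReal 1) (by simp)
  exact ⟨_, Real.exp_pos _, N, fun i hi => norm_le_of_logLog_le
    (logLog_le_of_kobayashiDist_lt hd hm (hN N le_rfl i hi))⟩

theorem exists_tendsto_of_cauchy (hD : IsOpen D) (hz : z ∉ D) (hw : w ∉ D) (hzw : z ≠ w)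
    {u : ℕ → ℂ} (huD : ∀ i, u i ∈ D)
    (hu : ∀ ε > 0, ∃ N, ∀ i ≥ N, ∀ j ≥ N, kobayashiDist D (u i) (u j) < ε) :
    ∃ q ∈ D, Tendsto (fun i => kobayashiDist D q (u i)) atTop (𝓝 0) := by
  have hdA : DifferentiableOn ℂ (affineMap z w) D := differentiable_affineMap.differentiableOn
  have hmA := mapsTo_affineMap hz hw hzw
  obtain ⟨P, hP, N, hN⟩ := exists_norm_le_of_cauchy hdA hmA hu
  have hcau : CauchySeq fun i => affineMap z w (u i) := by
    refine Metric.cauchySeq_iff'.mpr fun ε hε => ?_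
    obtain ⟨δ, hδ, h⟩ := exists_forall_norm_sub_lt hdA hmA hP.le hε
    obtain ⟨N', hN'⟩ := hu (ENNReal.ofReal δ) (ENNReal.ofReal_pos.mpr hδ)
    refine ⟨max N N', fun n hn => ?_⟩
    rw [dist_eq_norm]
    exact h _ _ (hN _ (le_max_left _ _)) (hN' _ (le_max_right _ _) _ ((le_max_right _ _).trans hn))
  obtain ⟨y, hy⟩ := cauchySeq_tendsto_of_complete hcau
  have hlim : Tendsto u atTop (𝓝 (z + (w - z) * y)) := by
    have h := (hy.const_mul (w - z)).const_add z
    simpa only [← eq_add_mul_affineMap hzw] using h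
  set q := z + (w - z) * y
  have hqD : q ∈ D := by
    by_contra hq
    -- With `v` a second omitted point, x ↦ (v - q) / (x - q) omits 0 and 1 on D but blows up along
    -- `u`, against the boundedness of Cauchy sequences.
    obtain ⟨v, hv, hvq⟩ : ∃ v, v ∉ D ∧ v ≠ q := by
      by_cases h : z = q
      · exact ⟨w, hw, fun h' => hzw (h.trans h'.symm)⟩
      · exact ⟨z, hz, h⟩
    have hne : ∀ x ∈ D, x - q ≠ 0 := fun x hx h => hq (sub_eq_zero.mp h ▸ hx)
    have hd : DifferentiableOn ℂ (fun x => (v - q) / (x - q)) D := by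
      fun_prop (disch := assumption)
    have hm : MapsTo (fun x => (v - q) / (x - q)) D {0, 1}ᶜ := by
      rintro x hx (h | h)
      · rcases div_eq_zero_iff.mp h with h | h
        · exact hvq (sub_eq_zero.mp h)
        · exact hne x hx h
      · rw [mem_singleton_iff, div_eq_one_iff_eq (hne x hx)] at h
        exact hv (sub_left_injective h ▸ hx)
    obtain ⟨P', hP', N', hN'⟩ := exists_norm_le_of_cauchy hd hm hu
    have hlim0 : Tendsto (fun i => P' * ‖u i - q‖) atTop (𝓝 0) := by
      simpa using ((hlim.sub_const q).norm.const_mul P')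
    have hle : ‖v - q‖ ≤ 0 := by
      refine ge_of_tendsto hlim0 ((eventually_ge_atTop N').mono fun i hi => ?_)
      have h := hN' i hi
      rwa [norm_div, div_le_iff₀ (norm_pos_iff.mpr (hne _ (huD i)))] at h
    exact hvq (sub_eq_zero.mp (norm_le_zero_iff.mp hle))
  exact ⟨q, hqD, (tendsto_kobayashiDist_nhds_zero hD hqD).comp hlim⟩

theorem isCompleteKobayashiHyperbolic_of_notMem (hD : IsOpen D) (hc : IsConnected D) (hz : z ∉ D)
    (hw : w ∉ D) (hzw : z ≠ w) : IsCompleteKobayashiHyperbolic D := by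
  refine ⟨isKobayashiHyperbolic_of_notMem hD hc hz hw hzw, ?_⟩
  refine @EMetric.complete_of_cauchySeq_tendsto D (kobayashiSpace D) fun u hu => ?_
  rw [@EMetric.cauchySeq_iff D ℕ (kobayashiSpace D)] at hu
  obtain ⟨q, hq, hlim⟩ := exists_tendsto_of_cauchy hD hz hw hzw (u := fun i => u i)
    (fun i => (u i).2) fun ε hε => by
      obtain ⟨N, hN⟩ := hu ε hε
      exact ⟨N, fun i hi j hj => hN i hi j hj⟩
  refine ⟨⟨q, hq⟩, ?_⟩
  refine (@tendsto_iff_edist_tendsto_0 D ℕ (kobayashiSpace D) atTop u ⟨q, hq⟩).mpr ?_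
  refine hlim.congr fun i => ?_
  exact kobayashiDist_comm D q (u i)

theorem landauProperty_of_notMem (hz : z ∉ D) (hw : w ∉ D) (hzw : z ≠ w) : LandauProperty D := by
  intro a ha
  have hwz : 0 < ‖w - z‖ := norm_pos_iff.mpr (sub_ne_zero.mpr hzw.symm)
  have hΦ := landauBound_pos (affineMap z w a)
  -- Rescaled to the unit disk and composed with `affineMap`, f would have derivative of modulus R /
  -- |w - z|, one more than Landau's bound.
  set R := ‖w - z‖ * (landauBound (affineMap z w a) + 1) with hR
  have hR0 : 0 < R := by positivity
  refine ⟨R, hR0, fun f hf hf0 hf1 hfD => ?_⟩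
  have hmaps : MapsTo (fun ζ : ℂ => R * ζ) (ball 0 1) (ball 0 R) := by
    intro ζ hζ
    rw [mem_ball_zero_iff] at hζ ⊢
    rw [norm_mul, Complex.norm_real, Real.norm_of_nonneg hR0.le]
    nlinarith
  have hg : (fun ζ => affineMap z w (f (R * ζ))) ∈ holMaps (ball 0 1) {0, 1}ᶜ :=
    ⟨differentiable_affineMap.comp_differentiableOn (hf.comp (by fun_prop) hmaps),
      fun ζ hζ => mapsTo_affineMap hz hw hzw (hfD (mem_image_of_mem f (hmaps hζ)))⟩
  have h := norm_deriv_zero_le_landauBound hg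
  have hd : HasDerivAt (fun ζ => affineMap z w (f (R * ζ))) (deriv f 0 * R / (w - z)) 0 := by
    have h1 : HasDerivAt (fun ζ : ℂ => (R : ℂ) * ζ) (R : ℂ) 0 := by
      simpa using (hasDerivAt_id (0 : ℂ)).const_mul (R : ℂ)
    have h2 : HasDerivAt f (deriv f 0) ((R : ℂ) * 0) := by
      rw [mul_zero]
      exact (hf.differentiableAt (ball_mem_nhds 0 hR0)).hasDerivAt
    exact ((HasDerivAt.comp (0 : ℂ) h2 h1).sub_const z).div_const (w - z)
  rw [hd.deriv, norm_div, norm_mul, hf1, Complex.norm_real, Real.norm_of_nonneg hR0.le, one_mul,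
    mul_zero, hf0, hR, mul_div_cancel_left₀ _ hwz.ne'] at h
  linarith

theorem abs_logLog_sub_le (hd : DifferentiableOn ℂ m D) (hm : MapsTo m D {0, 1}ᶜ) {f : ℂ → ℂ}
    (hf : f ∈ holMaps (ball 0 1) D) {ζ : ℂ} {r : ℝ} (hζ : ‖ζ‖ ≤ r) (hr : r < 1) :
    |logLog (m (f 0)) - logLog (m (f ζ))| ≤ 32000 * Real.log ((1 + r) / (1 - r)) := by
  have h1 := (lipschitzOnDisks_logLog.comp hd hm) f hf 0 (mem_ball_self one_pos) ζ
    (mem_ball_zero_iff.mpr (hζ.trans_lt hr))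
  have h2 := poincareDist_zero_left_le hζ hr
  linarith

theorem schottkyProperty_of_notMem (hz : z ∉ D) (hw : w ∉ D) (hzw : z ≠ w) :
    SchottkyProperty D := by
  intro a _ R _ r _ hr1
  have hdA : DifferentiableOn ℂ (affineMap z w) D := differentiable_affineMap.differentiableOn
  have hmA := mapsTo_affineMap hz hw hzw
  -- The exponent adds the two changes of `logLog`: from `a` to f(0), then from f(0) to f(ζ).
  refine ⟨‖z‖ + ‖w - z‖ * Real.exp (Real.exp (logLog (affineMap z w a) + 64000 * R +
    32000 * Real.log ((1 + r) / (1 - r)))), ?_, fun f hf hfR ζ hζ => ?_⟩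
  · have : 0 < ‖w - z‖ := norm_pos_iff.mpr (sub_ne_zero.mpr hzw.symm)
    positivity
  · refine norm_le_of_norm_affineMap_le hzw (norm_le_of_logLog_le ?_)
    have h1 := logLog_le_of_kobayashiDist_lt hdA hmA hfR
    have h2 := (abs_le.mp (abs_logLog_sub_le hdA hmA hf hζ hr1)).1
    linarith

end TwoPoints

/-! ### Normal families: Montel and Hurwitz -/

/-- Cauchy's estimate on circles of radius (1 - r)/2, which stay in |z| ≤ (1 + r)/2. -/
theorem lipschitz_of_norm_le {f : ℂ → ℂ} (hf : DifferentiableOn ℂ f (ball 0 1)) {r M : ℝ}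
    (hr : r < 1) (hM : ∀ z, ‖z‖ ≤ (1 + r) / 2 → ‖f z‖ ≤ M) {x y : ℂ} (hx : ‖x‖ ≤ r) (hy : ‖y‖ ≤ r) :
    ‖f x - f y‖ ≤ M / ((1 - r) / 2) * ‖x - y‖ := by
  have hs : 0 < (1 - r) / 2 := by linarith
  have hmem : ∀ z ∈ closedBall (0 : ℂ) r, z ∈ ball (0 : ℂ) 1 := fun z hz =>
    closedBall_subset_ball hr hz
  refine (convex_closedBall (0 : ℂ) r).norm_image_sub_le_of_norm_deriv_le
    (fun z hz => hf.differentiableAt (isOpen_ball.mem_nhds (hmem z hz))) (fun z hz => ?_)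
    (by simpa using hy) (by simpa using hx)
  have hz' : ‖z‖ ≤ r := by simpa using hz
  have hsub : ∀ y ∈ closedBall z ((1 - r) / 2), ‖y‖ ≤ (1 + r) / 2 := by
    intro y hy
    rw [mem_closedBall, dist_eq_norm] at hy
    linarith [norm_le_norm_add_norm_sub' y z]
  refine Complex.norm_deriv_le_of_forall_mem_sphere_norm_le hs ?_
    fun y hy => hM y (hsub y (sphere_subset_closedBall hy))
  refine (hf.mono fun y hy => ?_).diffContOnCl_ball subset_rfl
  rw [mem_ball_zero_iff]
  linarith [hsub y hy]

/-- Montel's theorem: a locally bounded sequence of holomorphic functions on the unit disk has a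
subsequence that converges uniformly on compact sets. -/
theorem exists_subseq_convergesOnCompacts {F : ℕ → ℂ → ℂ}
    (hF : ∀ n, DifferentiableOn ℂ (F n) (ball 0 1)) {M : ℝ → ℝ}
    (hM : ∀ r < 1, ∀ n z, ‖z‖ ≤ r → ‖F n z‖ ≤ M r) :
    ∃ φ : ℕ → ℕ, StrictMono φ ∧ ∃ g : ℂ → ℂ, DifferentiableOn ℂ g (ball 0 1) ∧
      ConvergesOnCompacts (ball 0 1) (fun n => F (φ n)) g := by
  let B := ball (0 : ℂ) 1
  have hB : ∀ x : B, ‖(x : ℂ)‖ < 1 := fun x => mem_ball_zero_iff.mp x.2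
  -- These conditions are closed under pointwise limits and force equicontinuity. So T is compact by
  -- Tychonoff, and Arzelà–Ascoli passes to the compact-open topology.
  let T : Set (B → ℂ) := {h | (∀ x, ‖h x‖ ≤ M ‖(x : ℂ)‖) ∧ ∀ r < 1, ∀ x y : B, ‖(x : ℂ)‖ ≤ r →
    ‖(y : ℂ)‖ ≤ r → ‖h x - h y‖ ≤ M ((1 + r) / 2) / ((1 - r) / 2) * ‖(x : ℂ) - y‖}
  have hnear : ∀ x₀ : B, ∃ A : ℝ, ∀ᶠ x in 𝓝 x₀, ∀ h ∈ T, ‖h x₀ - h x‖ ≤ A * dist x x₀ := by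
    intro x₀
    set ρ := (1 + ‖(x₀ : ℂ)‖) / 2 with hρ
    have h1 : ‖(x₀ : ℂ)‖ < ρ := by linarith [hB x₀]
    refine ⟨M ((1 + ρ) / 2) / ((1 - ρ) / 2), ?_⟩
    filter_upwards [(continuous_norm.comp continuous_subtype_val).continuousAt.eventually_lt
      continuousAt_const h1] with x hx h hT
    have h2 := hT.2 ρ (by linarith [hB x₀]) x₀ x h1.le hx.le
    rwa [norm_sub_rev (x₀ : ℂ), ← dist_eq_norm (x : ℂ), ← Subtype.dist_eq] at h2
  have hdist : ∀ x₀ : B, ∀ A : ℝ, Tendsto (fun x : B => A * dist x x₀) (𝓝 x₀) (𝓝 0) := by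
    intro x₀ A
    have h : Continuous fun x : B => A * dist x x₀ := by fun_prop
    simpa using h.tendsto x₀
  have hTcont : ∀ h ∈ T, Continuous h := by
    refine fun h hT => continuous_iff_continuousAt.mpr fun x₀ => ?_
    obtain ⟨A, hA⟩ := hnear x₀
    refine tendsto_iff_dist_tendsto_zero.mpr (squeeze_zero' (Eventually.of_forall fun _ =>
      dist_nonneg) ?_ (hdist x₀ A))
    filter_upwards [hA] with x hx
    rw [dist_comm, dist_eq_norm]
    exact hx h hT
  have hTcl : IsClosed T := by
    simp only [T, ofPred_and, ofPred_forall]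
    refine IsClosed.inter (isClosed_iInter fun x => ?_) (isClosed_iInter fun r =>
      isClosed_iInter fun _ => isClosed_iInter fun x => isClosed_iInter fun y =>
      isClosed_iInter fun _ => isClosed_iInter fun _ => ?_)
    · exact isClosed_le (by fun_prop) continuous_const
    · exact isClosed_le (by fun_prop) continuous_const
  have hTcomp : IsCompact T := by
    refine (isCompact_univ_pi fun x : B => isCompact_closedBall (0 : ℂ) (M ‖(x : ℂ)‖)).of_isClosed_subset
      hTcl fun h hT x _ => ?_
    simpa using hT.1 x
  have : LocallyCompactSpace B := isOpen_ball.locallyCompactSpace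
  have : FirstCountableTopology C(B, ℂ) := UniformSpace.firstCountableTopology _
  let S : Set C(B, ℂ) := {h | (h : B → ℂ) ∈ T}
  have hS : IsCompact S := by
    refine ArzelaAscoli.isCompact_of_equicontinuous S ?_ ?_
    · convert hTcomp
      ext h
      exact ⟨fun ⟨h', hh', he⟩ => he ▸ hh', fun hT => ⟨⟨h, hTcont h hT⟩, hT, rfl⟩⟩
    · intro x₀
      obtain ⟨A, hA⟩ := hnear x₀
      refine Metric.equicontinuousAt_of_continuity_modulus _ (hdist x₀ A) _ ?_
      filter_upwards [hA] with x hx h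
      rw [dist_eq_norm]
      exact hx _ h.2
  let f : ℕ → C(B, ℂ) := fun n => ⟨fun x => F n x, (hF n).continuousOn.domRestrict⟩
  have hfS : ∀ n, f n ∈ S := fun n => ⟨fun x => hM _ (hB x) n x le_rfl, fun r hr x y hx hy =>
    lipschitz_of_norm_le (hF n) hr (fun z hz => hM _ (by linarith) n z hz) hx hy⟩
  obtain ⟨g, -, φ, hφ, hlim⟩ := hS.tendsto_subseq hfS
  rw [ContinuousMap.tendsto_iff_forall_isCompact_tendstoUniformlyOn] at hlim
  classical
  let G : ℂ → ℂ := fun z => if h : z ∈ B then g ⟨z, h⟩ else 0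
  have hconv : ConvergesOnCompacts (ball 0 1) (fun n => F (φ n)) G := by
    intro K hKB hK
    have hK' : IsCompact ((↑) ⁻¹' K : Set B) := by
      rw [Subtype.isCompact_iff, Subtype.image_preimage_coe, inter_eq_right.mpr hKB]
      exact hK
    intro u hu
    filter_upwards [hlim _ hK' u hu] with n hn z hz
    have hG : G z = g ⟨z, hKB hz⟩ := dif_pos (hKB hz)
    rw [hG]
    exact hn ⟨z, hKB hz⟩ hz
  refine ⟨φ, hφ, G, ?_, hconv⟩
  refine TendstoLocallyUniformlyOn.differentiableOn (F := fun n => F (φ n)) (φ := atTop)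
    ?_ (Eventually.of_forall fun n => hF _) isOpen_ball
  exact (tendstoLocallyUniformlyOn_iff_forall_isCompact isOpen_ball).mpr hconv

/-- Hurwitz's theorem on values omitted by a limit of holomorphic functions. -/
theorem ConvergesOnCompacts.ne_of_forall_ne {F : ℕ → ℂ → ℂ} {g : ℂ → ℂ}
    (hF : ∀ n, DifferentiableOn ℂ (F n) (ball 0 1)) (hg : DifferentiableOn ℂ g (ball 0 1))
    (hlim : ConvergesOnCompacts (ball 0 1) F g) {w : ℂ} (hw : ∀ n, ∀ z ∈ ball (0 : ℂ) 1, F n z ≠ w)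
    {x₀ : ℂ} (hx₀ : x₀ ∈ ball (0 : ℂ) 1) (hgx : g x₀ ≠ w) : ∀ z ∈ ball (0 : ℂ) 1, g z ≠ w := by
  intro z₀ hz₀ hgz
  have hpre : IsPreconnected (ball (0 : ℂ) 1) := (convex_ball _ _).isPreconnected
  have han : AnalyticOnNhd ℂ g (ball 0 1) := hg.analyticOnNhd isOpen_ball
  have hev : ∀ᶠ z in 𝓝[≠] z₀, g z ≠ w := by
    refine ((han z₀ hz₀).eventually_eq_or_eventually_ne analyticAt_const).resolve_left fun h => ?_
    exact hgx (han.eqOn_of_preconnected_of_eventuallyEq analyticOnNhd_const hpre hz₀ h hx₀)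
  rw [eventually_nhdsWithin_iff] at hev
  obtain ⟨ρ, hρ, hball⟩ := Metric.nhds_basis_closedBall.mem_iff.mp
    (inter_mem hev (isOpen_ball.mem_nhds hz₀))
  have hsub : closedBall z₀ ρ ⊆ ball (0 : ℂ) 1 := fun z hz => (hball hz).2
  obtain ⟨y, hy, hmin⟩ := (isCompact_sphere z₀ ρ).exists_isMinOn
    (NormedSpace.sphere_nonempty.mpr hρ.le) (f := fun z => ‖g z - w‖)
    ((hg.continuousOn.mono (sphere_subset_closedBall.trans hsub)).sub continuousOn_const).norm
  set ε := ‖g y - w‖ with hε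
  have hε0 : 0 < ε := by
    refine norm_pos_iff.mpr (sub_ne_zero.mpr ((hball (sphere_subset_closedBall hy)).1 ?_))
    exact ne_of_mem_sphere hy hρ.ne'
  obtain ⟨n, hn⟩ := (Metric.tendstoUniformlyOn_iff.mp (hlim _ hsub (isCompact_closedBall z₀ ρ))
    (ε / 8) (by positivity)).exists
  have hn' : ∀ z ∈ closedBall z₀ ρ, ‖g z - F n z‖ < ε / 8 := fun z hz => by
    rw [← dist_eq_norm]; exact hn z hz
  have h0 := hn' z₀ (mem_closedBall_self hρ.le)
  rw [hgz] at h0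
  -- On the circle `F n` stays 3ε/4 away from `F n z₀`, so it covers the disk of radius 3ε/8 about
  -- `F n z₀`; this contains `w`, which lies within ε/8 of the centre.
  have hsph : ∀ z ∈ sphere z₀ ρ, 3 * ε / 4 ≤ ‖F n z - F n z₀‖ := by
    intro z hz
    have h1 : ε ≤ ‖g z - w‖ := hmin hz
    have h2 := hn' z (sphere_subset_closedBall hz)
    have h3 : g z - w = (g z - F n z) + (F n z - F n z₀) - (w - F n z₀) := by ring
    rw [h3] at h1
    have h4 := norm_sub_le ((g z - F n z) + (F n z - F n z₀)) (w - F n z₀)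
    have h5 := norm_add_le (g z - F n z) (F n z - F n z₀)
    linarith
  have hmem : w ∈ ball (F n z₀) (3 * ε / 4 / 2) := by
    rw [mem_ball, dist_eq_norm]
    linarith
  obtain ⟨z, hz, hzw⟩ := DiffContOnCl.ball_subset_image_closedBall
    (((hF n).mono hsub).diffContOnCl_ball subset_rfl) hρ hsph (fun h => by
      have h1 : F n =ᶠ[𝓝 z₀] fun _ => F n z₀ := by
        filter_upwards [h] with z hz using not_not.mp hz
      have h2 := ((hF n).analyticOnNhd isOpen_ball).eqOn_of_preconnected_of_eventuallyEq
        analyticOnNhd_const hpre hz₀ h1 (hsub (sphere_subset_closedBall hy))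
      have h3 := hsph y hy
      rw [h2, sub_self, norm_zero] at h3
      linarith) hmem
  exact hw n z (hsub hz) hzw

theorem montelProperty_of_notMem {D : Set ℂ} {z w : ℂ} (hz : z ∉ D) (hw : w ∉ D) (hzw : z ≠ w) :
    MontelProperty D := by
  intro F hF
  refine or_iff_not_imp_right.mpr fun hdiv => ?_
  have hdA : DifferentiableOn ℂ (affineMap z w) D := differentiable_affineMap.differentiableOn
  have hmA := mapsTo_affineMap hz hw hzw
  simp only [DivergesCompactly, not_forall, not_exists] at hdiv
  obtain ⟨K, hKB, hK, L, hLD, hL, hKL⟩ := hdiv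
  -- Without compact divergence, infinitely many `F n` send some point of `K` into `L`. There
  -- `logLog` is bounded, and the bound spreads via 0 to every smaller closed disk.
  have hfreq : ∃ᶠ n in atTop, ∃ ζ ∈ K, F n ζ ∈ L := by
    refine frequently_atTop'.mpr fun N => ?_
    obtain ⟨n, hn, h⟩ := hKL N
    obtain ⟨_, ⟨ζ, hζ, rfl⟩, hζL⟩ := nonempty_iff_ne_empty.mpr h
    exact ⟨n, hn, ζ, hζ, hζL⟩
  obtain ⟨φ, hφ, hζ⟩ := extraction_of_frequently_atTop hfreq
  choose ζ hζK hζL using hζ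
  obtain ⟨x, hxK, hx⟩ := hK.exists_isMaxOn ⟨ζ 0, hζK 0⟩ continuous_norm.continuousOn
  have hx1 : ‖x‖ < 1 := mem_ball_zero_iff.mp (hKB hxK)
  obtain ⟨T, hT⟩ := hL.bddAbove_image (f := fun q => logLog (affineMap z w q))
    (continuous_logLog.comp differentiable_affineMap.continuous).continuousOn
  have hbound : ∀ r < 1, ∀ n y, ‖y‖ ≤ r → ‖F (φ n) y‖ ≤ ‖z‖ + ‖w - z‖ * Real.exp (Real.exp
      (T + 32000 * Real.log ((1 + ‖x‖) / (1 - ‖x‖)) + 32000 * Real.log ((1 + r) / (1 - r)))) := by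
    intro r hr n y hy
    refine norm_le_of_norm_affineMap_le hzw (norm_le_of_logLog_le ?_)
    have h1 := (abs_le.mp (abs_logLog_sub_le hdA hmA (hF (φ n)) (hx (hζK n)) hx1)).2
    have h2 := (abs_le.mp (abs_logLog_sub_le hdA hmA (hF (φ n)) hy hr)).1
    have h3 := hT (mem_image_of_mem (fun q => logLog (affineMap z w q)) (hζL n))
    linarith
  obtain ⟨φ', hφ', g, hg, hconv⟩ := exists_subseq_convergesOnCompacts (F := fun n => F (φ n))
    (fun n => (hF (φ n)).1) hbound
  refine ⟨φ ∘ φ', hφ.comp hφ', g, ⟨hg, ?_⟩, hconv⟩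
  -- A limit point of the ζ's is sent by `g` into `L`, hence into D. By Hurwitz a value of `g`
  -- outside D, omitted by every `F n`, cannot occur.
  obtain ⟨y, hyK, φ'', hφ'', hy⟩ := hK.tendsto_subseq fun n => hζK (φ' n)
  have hyB := hKB hyK
  have hgy : g y ∈ D := by
    refine hLD (hL.isClosed.mem_of_tendsto (f := fun n => F (φ (φ' (φ'' n))) (ζ (φ' (φ'' n))))
      (b := atTop) ?_ (Eventually.of_forall fun n => hζL _))
    have h1 : Tendsto (fun n => g (ζ (φ' (φ'' n)))) atTop (𝓝 (g y)) :=
      (hg.continuousOn.continuousAt (isOpen_ball.mem_nhds hyB)).tendsto.comp hy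
    refine h1.congr_dist (Metric.tendsto_atTop.mpr fun ε hε => ?_)
    obtain ⟨N, hN⟩ := eventually_atTop.mp
      (hφ''.tendsto_atTop.eventually (Metric.tendstoUniformlyOn_iff.mp (hconv K hKB hK) ε hε))
    refine ⟨N, fun n hn => ?_⟩
    rw [Real.dist_0_eq_abs, abs_of_nonneg dist_nonneg]
    exact hN n hn _ (hζK _)
  intro v hv
  by_contra hgv
  refine hconv.ne_of_forall_ne (fun n => (hF _).1) hg
    (w := g v) (fun n u hu h => hgv ?_) hyB (fun h => hgv ?_) v hv rfl
  · rw [← h]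
    exact (hF (φ (φ' n))).2 hu
  · rwa [← h]

/-! ### Landau implies Picard; domains missing at most one point -/

/-- Where f' ≠ 0, rescaling the variable makes the derivative 1 on disks of every radius. -/
theorem LandauProperty.picardProperty {D : Set ℂ} (h : LandauProperty D) : PicardProperty D := by
  rintro f ⟨hf, hfD⟩
  have hf' : Differentiable ℂ f := differentiableOn_univ.mp hf
  refine ⟨f 0, fun z => is_const_of_deriv_eq_zero hf' (fun z₀ => ?_) z 0⟩
  by_contra h0
  obtain ⟨R, -, hR⟩ := h (f z₀) (hfD (mem_univ _))
  refine hR (fun ζ => f (z₀ + ζ / deriv f z₀)) (by fun_prop) (by simp) ?_ ?_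
  · have h1 : HasDerivAt (fun ζ : ℂ => z₀ + ζ / deriv f z₀) (1 / deriv f z₀) 0 :=
      ((hasDerivAt_id (0 : ℂ)).div_const _).const_add z₀
    have h2 : HasDerivAt f (deriv f z₀) (z₀ + 0 / deriv f z₀) := by
      simpa using (hf' z₀).hasDerivAt
    have h3 : HasDerivAt (fun ζ => f (z₀ + ζ / deriv f z₀)) (deriv f z₀ * (1 / deriv f z₀)) 0 :=
      HasDerivAt.comp (0 : ℂ) h2 h1
    rw [h3.deriv, mul_one_div_cancel h0, norm_one]
  · rintro _ ⟨ζ, -, rfl⟩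
    exact hfD (mem_univ _)

section OneMissingPoint

/-- The entire function `z ↦ w + exp (c z)`, which omits the value `w`. -/
noncomputable def expMap (w c z : ℂ) : ℂ := w + Complex.exp (c * z)

variable {D : Set ℂ} {w : ℂ}

theorem expMap_mem_holMaps (hw : ∀ z, z ≠ w → z ∈ D) (c : ℂ) (U : Set ℂ) :
    expMap w c ∈ holMaps U D := by
  refine ⟨?_, fun z _ => hw _ fun h => Complex.exp_ne_zero (c * z) (add_eq_left.mp h)⟩
  unfold expMap
  fun_prop

@[simp] theorem expMap_zero (c : ℂ) : expMap w c 0 = w + 1 := by simp [expMap]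

theorem add_one_mem (hw : ∀ z, z ≠ w → z ∈ D) : w + 1 ∈ D := hw _ (by simp)

theorem le_norm_expMap_half (n : ℕ) : (n : ℝ) / 2 ≤ ‖expMap w n (1 / 2)‖ + ‖w‖ := by
  have h1 : ‖Complex.exp (n * (1 / 2))‖ = Real.exp (n / 2) := by
    rw [Complex.norm_exp]
    congr 1
    simp [div_eq_mul_inv]
  have h2 := norm_le_norm_add_norm_sub' (Complex.exp (n * (1 / 2))) (-w)
  rw [sub_neg_eq_add, norm_neg, add_comm (Complex.exp _) w, h1] at h2
  have h3 := Real.add_one_le_exp ((n : ℝ) / 2)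
  unfold expMap
  linarith

theorem exp_one_ne_one : Complex.exp 1 ≠ 1 := by
  intro h
  have h1 : Real.exp 1 = 1 := by
    have := congrArg Complex.re h
    rwa [Complex.exp_re, Complex.one_re, Complex.one_im, Real.cos_zero, mul_one] at this
  exact one_ne_zero ((Real.exp_eq_one_iff 1).mp h1)

/-- The map w + exp (n z) sends 0 and 1/n to the fixed points w + 1 and w + e, while ω(0, 1/n) → 0.
-/
theorem not_isKobayashiHyperbolic (hw : ∀ z, z ≠ w → z ∈ D) : ¬ IsKobayashiHyperbolic D := by
  intro h
  have hq : w + Complex.exp 1 ∈ D := hw _ (by simp)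
  refine exp_one_ne_one (add_left_cancel ((h _ (add_one_mem hw) _ hq).2 ?_)).symm
  have hlim : Tendsto (fun n : ℕ => ENNReal.ofReal (poincareDist 0 (1 / (n : ℂ)))) atTop (𝓝 0) := by
    have hc : ContinuousAt (fun x : ℝ => ENNReal.ofReal (1 / 2 * Real.log ((1 + x) / (1 - x)))) 0 :=
      ENNReal.continuous_ofReal.continuousAt.comp (continuousAt_const.mul
        (ContinuousAt.log (ContinuousAt.div (by fun_prop) (by fun_prop) (by simp)) (by simp)))
    have := hc.tendsto.comp tendsto_one_div_atTop_nhds_zero_nat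
    simpa [poincareDist_zero_left, Function.comp_def] using this
  refine le_antisymm (ge_of_tendsto hlim ?_) bot_le
  filter_upwards [eventually_gt_atTop 1] with n hn
  have hn0 : (n : ℂ) ≠ 0 := by exact_mod_cast (by omega : n ≠ 0)
  have hb : 1 / (n : ℂ) ∈ ball (0 : ℂ) 1 := by
    rw [mem_ball_zero_iff, norm_div, norm_one, Complex.norm_natCast]
    exact (div_lt_one (by positivity)).mpr (by exact_mod_cast hn)
  have h1 := kobayashiDist_le_poincareDist (expMap_mem_holMaps hw n (ball 0 1))
    (mem_ball_self one_pos) hb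
  rwa [expMap_zero, expMap, mul_one_div_cancel hn0] at h1

theorem not_schottkyProperty (hw : ∀ z, z ≠ w → z ∈ D) : ¬ SchottkyProperty D := by
  intro h
  obtain ⟨M, -, hM⟩ := h _ (add_one_mem hw) 1 one_pos (1 / 2) (by norm_num) (by norm_num)
  obtain ⟨n, hn⟩ := exists_nat_gt (2 * (M + ‖w‖))
  have h1 := hM _ (expMap_mem_holMaps hw n (ball 0 1))
    (by rw [expMap_zero, kobayashiDist_self (add_one_mem hw)]; simp) (1 / 2) (by simp)
  linarith [le_norm_expMap_half (w := w) n]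

theorem not_picardProperty (hw : ∀ z, z ≠ w → z ∈ D) : ¬ PicardProperty D := by
  intro h
  obtain ⟨c, hc⟩ := h _ (expMap_mem_holMaps hw 1 univ)
  have h1 := (hc 1).trans (hc 0).symm
  rw [expMap_zero, expMap, mul_one] at h1
  exact exp_one_ne_one (add_left_cancel h1)

/-- The maps w + exp (n z) are unbounded at 1/2, so no subsequence converges, but all equal w + 1 at
0, so they do not diverge compactly. -/
theorem not_montelProperty (hw : ∀ z, z ≠ w → z ∈ D) : ¬ MontelProperty D := by
  intro h
  rcases h (fun n => expMap w n) fun n => expMap_mem_holMaps hw n _ with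
    ⟨φ, hφ, g, -, hconv⟩ | hdiv
  · have h1 := Metric.tendstoUniformlyOn_iff.mp
      (hconv {1 / 2} (singleton_subset_iff.mpr (by simp; norm_num)) isCompact_singleton) 1 one_pos
    obtain ⟨N, hN⟩ := exists_nat_gt (2 * (‖g (1 / 2)‖ + 1 + ‖w‖))
    obtain ⟨n, hn, hnN⟩ := (h1.and (eventually_ge_atTop N)).exists
    have h2 := hn _ (mem_singleton _)
    rw [dist_comm, dist_eq_norm] at h2
    have h3 := norm_le_norm_add_norm_sub' (expMap w (φ n) (1 / 2)) (g (1 / 2))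
    have h4 := le_norm_expMap_half (w := w) (φ n)
    have h5 : (N : ℝ) ≤ φ n := by exact_mod_cast hnN.trans (hφ.id_le n)
    linarith
  · obtain ⟨N, hN⟩ := hdiv {0} (by simp) isCompact_singleton {w + 1}
      (singleton_subset_iff.mpr (add_one_mem hw)) isCompact_singleton
    simpa using hN (N + 1) (by omega)

end OneMissingPoint

/-! ### The equivalence -/

theorem mainTheorem2 (D : Set ℂ) (hopen : IsOpen D) (hconn : IsConnected D) :
    List.TFAE
      [∃ z w : ℂ, z ∉ D ∧ w ∉ D ∧ z ≠ w,
       IsKobayashiHyperbolic D,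
       IsCompleteKobayashiHyperbolic D,
       LandauProperty D,
       SchottkyProperty D,
       PicardProperty D,
       MontelProperty D] := by
  have key : (¬ ∃ z w : ℂ, z ∉ D ∧ w ∉ D ∧ z ≠ w) → ∃ w, ∀ z, z ≠ w → z ∈ D := by
    intro h
    by_cases hD : ∃ w, w ∉ D
    · obtain ⟨w, hw⟩ := hD
      exact ⟨w, fun z hz => by_contra fun hzD => h ⟨z, w, hzD, hw, hz⟩⟩
    -- When D is the whole plane, any point can play the role of `w`.
    · exact ⟨0, fun z _ => by_contra fun hz => hD ⟨z, hz⟩⟩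
  tfae_have 1 → 3 := fun ⟨_, _, hz, hw, hzw⟩ =>
    isCompleteKobayashiHyperbolic_of_notMem hopen hconn hz hw hzw
  tfae_have 1 → 4 := fun ⟨_, _, hz, hw, hzw⟩ => landauProperty_of_notMem hz hw hzw
  tfae_have 1 → 5 := fun ⟨_, _, hz, hw, hzw⟩ => schottkyProperty_of_notMem hz hw hzw
  tfae_have 1 → 7 := fun ⟨_, _, hz, hw, hzw⟩ => montelProperty_of_notMem hz hw hzw
  tfae_have 3 → 2 := fun h => h.1
  tfae_have 4 → 6 := LandauProperty.picardProperty
  tfae_have 2 → 1 := fun h => by_contra fun h1 => (key h1).elim fun _ hw =>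
    not_isKobayashiHyperbolic hw h
  tfae_have 5 → 1 := fun h => by_contra fun h1 => (key h1).elim fun _ hw =>
    not_schottkyProperty hw h
  tfae_have 6 → 1 := fun h => by_contra fun h1 => (key h1).elim fun _ hw =>
    not_picardProperty hw h
  tfae_have 7 → 1 := fun h => by_contra fun h1 => (key h1).elim fun _ hw =>
    not_montelProperty hw h
  tfae_finish
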